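/- Let $I=[0,1]$, let $x^\ast\in I$ be a fixed anchor and $q:=\frac13-x^\ast(1-x^\ast)$. Let $\gamma=\{\gamma_\omega\}$ be non-negative weights indexed by the finite subsets $\omega$ of $\mathbb N$, with $\gamma_\emptyset=1$ and with support $\omega_\gamma:=\{\omega:\gamma_\omega>0\}$ closed under taking subsets. Assume that there are numbers $\alpha_\omega>0$ ($\omega\in\omega_\gamma$) and constants $0<C',C''<\infty$ such that for all $\omega\in\omega_\gamma$ $$\sum_{\eta\in\omega_\gamma,\ \eta\supset\omega} q^{|\eta|}\alpha_\eta\le C' q^{|\omega|}\alpha_\omega ,\qquad \sum_{\eta\in\omega_\gamma,\ \eta\subset\omega}\frac{\alpha_\eta}{\gamma_\eta}\le C''\,\frac{\alpha_\omega}{\gamma_\omega}.$$ For functions $f$ on $I^{\mathbb N}$ consider the ANOVA terms $f_\omega=\sum_{\omega'\subset\omega}(-1)^{|\omega|-|\omega'|}P_{\omega'}P_{\omega^c}f$ and the anchored terms $f'_\omega=\sum_{\omega'\subset\omega}(-1)^{|\omega|-|\omega'|}P'_{\omega'}P'_{\omega^c}f$, where $P_S$ integrates over $I$ each variable with index in $S$,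 and $P'_S$ sets these variables equal to $x^\ast$. Let $f_\omega^{(\omega)}$ and ${f'_\omega}^{(\omega)}$ be the mixed first derivatives with respect to all variables with index in $\omega$, and put $$\|f\|_{\gamma,A}^2=\sum_{\omega\in\omega_\gamma}\gamma_\omega^{-1}\|f_\omega^{(\omega)}\|_{L_2}^2,\qquad \|f\|_{\gamma,an}^2=\sum_{\omega\in\omega_\gamma}\gamma_\omega^{-1}\|{f'_\omega}^{(\omega)}\|_{L_2}^2 .$$ Let $f$ be an element of the completion, with respect to either of these two norms, of the linear span of all tensor products $\prod_{k\in\omega}u_k(x_k)$ with $\omega\in\omega_\gamma$ and $u_k\in H^1(I)$; that is, $f$ is given by a Cauchy sequence in this span. Then the derivatives $f_\omega^{(\omega)}$ and ${f'_\omega}^{(\omega)}$, $\omega\in\omega_\gamma$, of the terms of both decompositions of $f$ are well-defined as $L_2$ limits along the sequence, both norms of $f$ are finite, and the weighted total sensitivity indices $$S_{\omega_0,\mathrm{tot}}^{A,\gamma}=\sum_{\omega\in\omega_\gamma,\ \omega\supset\omega_0}\frac{\gamma_\omega^{-1}\|f_\omega^{(\omega)}\|_{L_2}^2}{\|f\|_{\gamma,A}^2},\qquad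 S_{\omega_0,\mathrm{tot}}^{an,\gamma}=\sum_{\omega\in\omega_\gamma,\ \omega\supset\omega_0}\frac{\gamma_\omega^{-1}\|{f'_\omega}^{(\omega)}\|_{L_2}^2}{\|f\|_{\gamma,an}^2}$$ (with $0/0=0$ if $f=0$) are comparable: for every $\omega_0\in\omega_\gamma$ they are either both zero or satisfy $$C^{-2}\le S_{\omega_0,\mathrm{tot}}^{A,\gamma}\,/\,S_{\omega_0,\mathrm{tot}}^{an,\gamma}\le C^2,\qquad C:=C'C''$$ (this $C$ is the constant in the norm equivalence for the squared norms, $C^{-1}\|f\|_{\gamma,an}^2\le\|f\|_{\gamma,A}^2\le C\|f\|_{\gamma,an}^2$). -/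

import Mathlib

open MeasureTheory Filter Topology
open scoped ENNReal

noncomputable section

namespace WeightedSobol

/-! Points of the infinite-dimensional unit cube are written as sequences `x : ℕ → ℝ`; the measure
`cubeMeasure` is carried by `[0,1]^ℕ`, so values outside the cube play no role. -/

/-- Lebesgue measure on the unit interval. -/
def intervalMeasure : Measure ℝ := volume.restrict (Set.Icc 0 1)

instance : IsProbabilityMeasure intervalMeasure :=
  ⟨by simp [intervalMeasure]⟩

/-- The infinite product of the Lebesgue measures on the unit interval. -/
def cubeMeasure : Measure (ℕ → ℝ) := Measure.infinitePi fun _ => intervalMeasure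

/-- The univariate Sobolev space `H¹([0,1])`: absolutely continuous functions on `[0,1]` with
square integrable derivative. -/
def MemH1 (u : ℝ → ℝ) : Prop :=
  AbsolutelyContinuousOnInterval u 0 1 ∧ MemLp (deriv u) 2 intervalMeasure

/-- The standing assumptions on the weights: they are non-negative, the weight of the empty set is
`1`, and the support `{ω : 0 < γ ω}` is closed under taking subsets. -/
structure IsWeight (γ : Finset ℕ → ℝ) : Prop where
  nonneg : ∀ ω, 0 ≤ γ ω
  empty : γ ∅ = 1
  monotone_support : ∀ ω η, η ⊆ ω → 0 < γ ω → 0 < γ η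

/-- The linear span of the tensor products `x ↦ ∏ k ∈ ω, u k (x k)` with factors in `H¹([0,1])`,
where `ω` ranges over the support of the weights. -/
def tensorSpan (γ : Finset ℕ → ℝ) : Submodule ℝ ((ℕ → ℝ) → ℝ) :=
  Submodule.span ℝ {f | ∃ (ω : Finset ℕ) (u : ℕ → ℝ → ℝ),
    0 < γ ω ∧ (∀ k ∈ ω, MemH1 (u k)) ∧ f = fun x => ∏ k ∈ ω, u k (x k)}

open Classical in
/-- `P_S`: integrate out the variables with index in `S`. -/
def integrateOut (S : Set ℕ) (f : (ℕ → ℝ) → ℝ) : (ℕ → ℝ) → ℝ :=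
  fun x => ∫ t, f (S.piecewise t x) ∂cubeMeasure

open Classical in
/-- `P'_S`: set the variables with index in `S` equal to the anchor `a`. -/
def anchorAt (a : ℝ) (S : Set ℕ) (f : (ℕ → ℝ) → ℝ) : (ℕ → ℝ) → ℝ :=
  fun x => f (S.piecewise (fun _ => a) x)

/-- The term `f_ω = ∑_{ω' ⊆ ω} (-1)^{|ω|-|ω'|} P_{ω'} P_{ωᶜ} f` of the ANOVA decomposition. -/
def anovaTerm (ω : Finset ℕ) (f : (ℕ → ℝ) → ℝ) : (ℕ → ℝ) → ℝ :=
  fun x => ∑ η ∈ ω.powerset, (-1 : ℝ) ^ (ω.card - η.card) *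
    integrateOut (η : Set ℕ) (integrateOut ((ω : Set ℕ)ᶜ) f) x

/-- The term `f'_ω = ∑_{ω' ⊆ ω} (-1)^{|ω|-|ω'|} P'_{ω'} P'_{ωᶜ} f` of the decomposition anchored
at `a`. -/
def anchoredTerm (a : ℝ) (ω : Finset ℕ) (f : (ℕ → ℝ) → ℝ) : (ℕ → ℝ) → ℝ :=
  fun x => ∑ η ∈ ω.powerset, (-1 : ℝ) ^ (ω.card - η.card) *
    anchorAt a (η : Set ℕ) (anchorAt a ((ω : Set ℕ)ᶜ) f) x

/-- The partial derivative with respect to the `k`-th variable. -/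
def partialDeriv (k : ℕ) (f : (ℕ → ℝ) → ℝ) : (ℕ → ℝ) → ℝ :=
  fun x => deriv (fun t => f (Function.update x k t)) (x k)

/-- The mixed first derivative with respect to all variables with index in `ω` (for `ω = ∅` this is
the function itself). -/
def mixedDeriv (ω : Finset ℕ) (f : (ℕ → ℝ) → ℝ) : (ℕ → ℝ) → ℝ :=
  ω.sort.foldr partialDeriv f

/-- `∑_{ω ⊇ ω₀} γ_ω⁻¹ ‖g_ω‖²`, the sum being over sets `ω` in the support of `γ`. The functions `g_ω`
will depend on the variables in `ω` only, so their `L₂` norms over the infinite-dimensional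
cube and over `[0,1]^ω` coincide. -/
def weightedSum (γ : Finset ℕ → ℝ) (g : Finset ℕ → (ℕ → ℝ) → ℝ) (ω₀ : Finset ℕ) : ℝ≥0∞ :=
  ∑' ω : {ω : Finset ℕ // 0 < γ ω ∧ ω₀ ⊆ ω},
    ENNReal.ofReal (γ ω.1)⁻¹ * eLpNorm (g ω.1) 2 cubeMeasure ^ 2

/-- The square of the norm built from the mixed derivatives `g_ω` of the terms of a
decomposition: `∑_ω γ_ω⁻¹ ‖g_ω‖²`. -/
def normSq (γ : Finset ℕ → ℝ) (g : Finset ℕ → (ℕ → ℝ) → ℝ) : ℝ≥0∞ := weightedSum γ g ∅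

/-- The mixed derivatives `f_ω^{(ω)}` of the ANOVA terms. -/
def anovaDeriv (f : (ℕ → ℝ) → ℝ) (ω : Finset ℕ) : (ℕ → ℝ) → ℝ :=
  mixedDeriv ω (anovaTerm ω f)

/-- The mixed derivatives `f'_ω^{(ω)}` of the terms anchored at `a`. -/
def anchoredDeriv (a : ℝ) (f : (ℕ → ℝ) → ℝ) (ω : Finset ℕ) : (ℕ → ℝ) → ℝ :=
  mixedDeriv ω (anchoredTerm a ω f)

/-- The squared weighted ANOVA norm `‖f‖²_{γ,A}`. -/
def anovaNormSq (γ : Finset ℕ → ℝ) (f : (ℕ → ℝ) → ℝ) : ℝ≥0∞ := normSq γ (anovaDeriv f)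

/-- The squared weighted anchored norm `‖f‖²_{γ,an}`. -/
def anchoredNormSq (a : ℝ) (γ : Finset ℕ → ℝ) (f : (ℕ → ℝ) → ℝ) : ℝ≥0∞ :=
  normSq γ (anchoredDeriv a f)

/-- `F` is a Cauchy sequence in `tensorSpan γ` with respect to the norm with square `N`; such
sequences represent the elements of the completion. -/
def RepresentsElement (γ : Finset ℕ → ℝ) (N : ((ℕ → ℝ) → ℝ) → ℝ≥0∞)
    (F : ℕ → (ℕ → ℝ) → ℝ) : Prop :=
  (∀ n, F n ∈ tensorSpan γ) ∧
    Tendsto (fun p : ℕ × ℕ => N (F p.1 - F p.2)) atTop (𝓝 0)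

/-- `g_ω` is the `L₂` limit of `D (F n) ω` for each `ω` in the support of `γ`. -/
def IsLimitFamily (γ : Finset ℕ → ℝ) (D : ((ℕ → ℝ) → ℝ) → Finset ℕ → (ℕ → ℝ) → ℝ)
    (F : ℕ → (ℕ → ℝ) → ℝ) (g : Finset ℕ → (ℕ → ℝ) → ℝ) : Prop :=
  ∀ ω, 0 < γ ω → MemLp (g ω) 2 cubeMeasure ∧
    Tendsto (fun n => eLpNorm (D (F n) ω - g ω) 2 cubeMeasure) atTop (𝓝 0)

/-- The weighted sensitivity index `S_ω = γ_ω⁻¹ ‖g_ω‖² / ∑_{ω'} γ_{ω'}⁻¹ ‖g_{ω'}‖²`. -/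
def sobolIndex (γ : Finset ℕ → ℝ) (g : Finset ℕ → (ℕ → ℝ) → ℝ) (ω : Finset ℕ) : ℝ≥0∞ :=
  ENNReal.ofReal (γ ω)⁻¹ * eLpNorm (g ω) 2 cubeMeasure ^ 2 / normSq γ g

/-- The weighted total sensitivity index `∑_{ω ⊇ ω₀} S_ω`. -/
def totalIndex (γ : Finset ℕ → ℝ) (g : Finset ℕ → (ℕ → ℝ) → ℝ) (ω₀ : Finset ℕ) : ℝ :=
  (∑' ω : {ω : Finset ℕ // 0 < γ ω ∧ ω₀ ⊆ ω}, sobolIndex γ g ω.1).toReal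

/-- The constant `q = 1/3 - a (1 - a)`. -/
def anchorConst (a : ℝ) : ℝ := 1 / 3 - a * (1 - a)

/-- `∑_{η ⊇ ω} q^|η| α_η ≤ C' q^|ω| α_ω` for all `ω`, over sets in the support of `γ`. -/
def UpperSumCondition (a : ℝ) (γ α : Finset ℕ → ℝ) (C' : ℝ) : Prop :=
  ∀ ω, 0 < γ ω →
    Summable (fun η : {η : Finset ℕ // 0 < γ η ∧ ω ⊆ η} =>
      anchorConst a ^ η.1.card * α η.1) ∧
    ∑' η : {η : Finset ℕ // 0 < γ η ∧ ω ⊆ η}, anchorConst a ^ η.1.card * α η.1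
      ≤ C' * (anchorConst a ^ ω.card * α ω)

open Classical in
/-- `∑_{η ⊆ ω} α_η / γ_η ≤ C'' α_ω / γ_ω` for all `ω`, over sets in the support of `γ`. -/
def LowerSumCondition (γ α : Finset ℕ → ℝ) (C'' : ℝ) : Prop :=
  ∀ ω, 0 < γ ω →
    ∑ η ∈ ω.powerset with 0 < γ η, α η / γ η ≤ C'' * (α ω / γ ω)

end WeightedSobol

end

noncomputable section

namespace WeightedSobol

/-! ### Functions on the unit interval -/

/-! For `u` in `H¹`, integration by parts gives `u a - ∫ u = ∫ K u'`, where the kernel `K` satisfies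
`∫ K² = q`. So the mean and the point evaluation at the anchor, the functionals behind the two
decompositions, differ by integration of the derivative against `±K`.

On a tensor product, the mixed derivative of the `ω`-term is, up to sign, the product of the `u_k'`
over `ω` times the functional applied to the remaining factors. Replacing one functional by the
other in those factors and expanding the product expresses the derivative for `ω` in one
decomposition as the sum over `s` disjoint from `ω` of averages, against `∏ k ∈ s, K`, of the
derivative for `ω ∪ s` in the other (`tensorDeriv_eq_sum_kernelAverage`). Each average has `L₂` norm
at most `q^(|s|/2)` times that of the averaged function (`eLpNorm_kernelAverage_le`).

Only supersets of `ω` occur. Hence Cauchy–Schwarz with weights `α`, followed by an exchange of sums,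
bounds not only the full squared norm but every partial sum over `ω ⊇ ω₀`, with the same constant `C
= C' C''` and in both directions (`sum_inv_mul_sq_le`). A total index is a quotient of two such
sums, which costs `C` twice.

For the completion, the weighted sums are squared norms in one `L₂` space over a disjoint union of
cubes. Completeness yields all limit derivatives at once, and the inequalities pass to the limit
(`exists_limit_family`). -/

lemma integral_intervalMeasure (f : ℝ → ℝ) :
    ∫ t, f t ∂intervalMeasure = ∫ t in (0 : ℝ)..1, f t := by
  rw [intervalMeasure, integral_Icc_eq_integral_Ioc, intervalIntegral.integral_of_le zero_le_one]

lemma integrable_intervalMeasure_iff {f : ℝ → ℝ} :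
    Integrable f intervalMeasure ↔ IntervalIntegrable f volume 0 1 := by
  rw [intervalIntegrable_iff_integrableOn_Icc_of_le zero_le_one]
  rfl

/-- The kernel `t ↦ t - 1_{t > a}`, which represents `u ↦ u a - ∫ u` in terms of `u'`. -/
def anchorKernel (a t : ℝ) : ℝ := if t ≤ a then t else t - 1

lemma measurable_anchorKernel (a : ℝ) : Measurable (anchorKernel a) :=
  Measurable.ite measurableSet_Iic measurable_id (measurable_id.sub_const 1)

lemma anchorConst_pos (a : ℝ) : 0 < anchorConst a := by
  unfold anchorConst
  nlinarith [sq_nonneg (a - 1 / 2)]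

/-- The kernel is affine on each side of the anchor. The second argument of `h` leaves room for a
further factor such as `u'`, so that one splitting serves both `∫ K²` and `∫ K u'`. -/
lemma integral_split_anchor {a : ℝ} (ha : a ∈ Set.Icc (0 : ℝ) 1) (h : ℝ → ℝ → ℝ)
    (h0 : IntervalIntegrable (fun t => h t t) volume 0 a)
    (h1 : IntervalIntegrable (fun t => h (t - 1) t) volume a 1) :
    IntervalIntegrable (fun t => h (anchorKernel a t) t) volume 0 1 ∧
    ∫ t in (0 : ℝ)..1, h (anchorKernel a t) t =
      (∫ t in (0 : ℝ)..a, h t t) + ∫ t in a..1, h (t - 1) t := by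
  have e0 : Set.EqOn (fun t => h t t) (fun t => h (anchorKernel a t) t) (Set.uIoc 0 a) := by
    intro t ht
    rw [Set.uIoc_of_le ha.1] at ht
    simp [anchorKernel, ht.2]
  have e1 : Set.EqOn (fun t => h (t - 1) t) (fun t => h (anchorKernel a t) t)
      (Set.uIoc a 1) := by
    intro t ht
    rw [Set.uIoc_of_le ha.2] at ht
    simp [anchorKernel, not_le.2 ht.1]
  have i0 := h0.congr e0
  have i1 := h1.congr e1
  refine ⟨i0.trans i1, ?_⟩
  rw [← intervalIntegral.integral_add_adjacent_intervals i0 i1]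
  congr 1
  · exact (intervalIntegral.integral_congr_ae (ae_of_all _ e0)).symm
  · exact (intervalIntegral.integral_congr_ae (ae_of_all _ e1)).symm

lemma integrable_anchorKernel_sq {a : ℝ} (ha : a ∈ Set.Icc (0 : ℝ) 1) :
    Integrable (fun t => anchorKernel a t ^ 2) intervalMeasure := by
  rw [integrable_intervalMeasure_iff]
  exact (integral_split_anchor ha (fun s _ => s ^ 2)
    (Continuous.intervalIntegrable (by fun_prop) _ _)
    (Continuous.intervalIntegrable (by fun_prop) _ _)).1

lemma integral_anchorKernel_sq {a : ℝ} (ha : a ∈ Set.Icc (0 : ℝ) 1) :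
    ∫ t, anchorKernel a t ^ 2 ∂intervalMeasure = anchorConst a := by
  rw [integral_intervalMeasure, (integral_split_anchor ha (fun s _ => s ^ 2)
    (Continuous.intervalIntegrable (by fun_prop) _ _)
    (Continuous.intervalIntegrable (by fun_prop) _ _)).2,
    intervalIntegral.integral_comp_sub_right (fun s => s ^ 2), integral_pow, integral_pow,
    anchorConst]
  -- The two pieces give `(a³ + (1 - a)³) / 3`, which is `1/3 - a (1 - a)`.
  norm_num
  ring

lemma memLp_anchorKernel {a : ℝ} (ha : a ∈ Set.Icc (0 : ℝ) 1) :
    MemLp (anchorKernel a) 2 intervalMeasure :=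
  (memLp_two_iff_integrable_sq (measurable_anchorKernel a).aestronglyMeasurable).2
    (integrable_anchorKernel_sq ha)

lemma memH1_const (c : ℝ) : MemH1 fun _ => c := by
  refine ⟨?_, by simp⟩
  exact (contDiff_const (c := c)).contDiffOn.absolutelyContinuousOnInterval

lemma MemH1.integrable {u : ℝ → ℝ} (hu : MemH1 u) : Integrable u intervalMeasure :=
  integrable_intervalMeasure_iff.2 hu.1.continuousOn.intervalIntegrable

lemma MemH1.ae_differentiableAt {u : ℝ → ℝ} (hu : MemH1 u) :
    ∀ᵐ t ∂intervalMeasure, DifferentiableAt ℝ u t := by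
  rw [intervalMeasure, ae_restrict_iff' measurableSet_Icc]
  filter_upwards [hu.1.ae_differentiableAt] with t ht h
  exact ht (by rwa [Set.uIcc_of_le zero_le_one])

lemma absolutelyContinuous_sub_const (c x y : ℝ) :
    AbsolutelyContinuousOnInterval (fun t => t - c) x y :=
  (contDiff_id.sub contDiff_const : ContDiff ℝ 1 fun t : ℝ => t - c).contDiffOn
    |>.absolutelyContinuousOnInterval

/-- `u a - ∫ u = ∫ K u'` for the kernel `K` of the anchor `a`. -/
lemma MemH1.integral_anchorKernel_mul_deriv {a : ℝ} (ha : a ∈ Set.Icc (0 : ℝ) 1) {u : ℝ → ℝ}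
    (hu : MemH1 u) :
    ∫ t, anchorKernel a t * deriv u t ∂intervalMeasure = u a - ∫ t, u t ∂intervalMeasure := by
  have s0 : Set.uIcc 0 a ⊆ Set.uIcc 0 1 := Set.uIcc_subset_uIcc_left (by
    rwa [Set.uIcc_of_le zero_le_one])
  have s1 : Set.uIcc a 1 ⊆ Set.uIcc 0 1 := Set.uIcc_subset_uIcc_right (by
    rwa [Set.uIcc_of_le zero_le_one])
  have u0 := hu.1.mono s0
  have u1 := hu.1.mono s1
  -- The primitives `t` on `[0, a]` and `t - 1` on `[a, 1]` vanish at the outer endpoints. The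
  -- boundary terms left are `a * u a` and `(1 - a) * u a`, which add up to `u a`.
  have p0 := (absolutelyContinuous_sub_const 0 0 a).integral_mul_deriv_eq_deriv_mul u0
  have p1 := (absolutelyContinuous_sub_const 1 a 1).integral_mul_deriv_eq_deriv_mul u1
  simp only [deriv_sub_const_fun, deriv_id'', one_mul, sub_zero, sub_self, zero_mul,
    zero_sub] at p0 p1
  rw [integral_intervalMeasure, integral_intervalMeasure,
    (integral_split_anchor ha (fun s t => s * deriv u t)
    (u0.intervalIntegrable_deriv.continuousOn_mul (by fun_prop))
    (u1.intervalIntegrable_deriv.continuousOn_mul (by fun_prop))).2, p0, p1,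
    ← intervalIntegral.integral_add_adjacent_intervals u0.continuousOn.intervalIntegrable
      u1.continuousOn.intervalIntegrable]
  ring

/-! ### Products and rearrangements on the infinite-dimensional cube -/

instance : IsProbabilityMeasure cubeMeasure := by unfold cubeMeasure; infer_instance

lemma measurePreserving_eval_cubeMeasure (k : ℕ) :
    MeasurePreserving (Function.eval k) cubeMeasure intervalMeasure :=
  measurePreserving_eval_infinitePi (fun _ => intervalMeasure) k

lemma integrable_prod_cubeMeasure {ω : Finset ℕ} {g : ℕ → ℝ → ℝ}
    (hg : ∀ k ∈ ω, Integrable (g k) intervalMeasure) :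
    Integrable (fun x : ℕ → ℝ => ∏ k ∈ ω, g k (x k)) cubeMeasure := by
  have h : Integrable (fun y : ω → ℝ => ∏ k : ω, g k (y k))
      (Measure.pi fun _ : ω => intervalMeasure) :=
    Integrable.fintype_prod (f := fun k : ω => g k) fun k => hg k k.2
  rw [← Measure.infinitePi_map_restrict (fun _ : ℕ => intervalMeasure)] at h
  have h' := h.comp_measurable (Finset.measurable_restrict ω)
  refine h'.congr (ae_of_all _ fun x => ?_)
  simp

lemma integral_prod_cubeMeasure {ω : Finset ℕ} {g : ℕ → ℝ → ℝ}
    (hg : ∀ k ∈ ω, Integrable (g k) intervalMeasure) :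
    ∫ x, ∏ k ∈ ω, g k (x k) ∂cubeMeasure = ∏ k ∈ ω, ∫ t, g k t ∂intervalMeasure := by
  have h : Integrable (fun y : ω → ℝ => ∏ k : ω, g k (y k))
      (Measure.pi fun _ : ω => intervalMeasure) :=
    Integrable.fintype_prod (f := fun k : ω => g k) fun k => hg k k.2
  have e := integral_restrict_infinitePi (μ := fun _ : ℕ => intervalMeasure)
    h.aestronglyMeasurable
  rw [integral_fintype_prod_eq_prod (fun k : ω => g k),
    Finset.prod_coe_sort ω fun k => ∫ t, g k t ∂intervalMeasure] at e
  rw [← e, cubeMeasure]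
  congr 1 with x
  simp

lemma memLp_prod_cubeMeasure {ω : Finset ℕ} {g : ℕ → ℝ → ℝ} (hm : ∀ k, Measurable (g k))
    (hg : ∀ k ∈ ω, MemLp (g k) 2 intervalMeasure) :
    MemLp (fun x : ℕ → ℝ => ∏ k ∈ ω, g k (x k)) 2 cubeMeasure := by
  rw [memLp_two_iff_integrable_sq (Measurable.aestronglyMeasurable (by fun_prop))]
  simp_rw [← Finset.prod_pow]
  exact integrable_prod_cubeMeasure (g := fun k t => g k t ^ 2)
    fun k hk => (hg k hk).integrable_sq

lemma measurable_piecewise_prod (S : Set ℕ) [∀ k, Decidable (k ∈ S)] :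
    Measurable fun p : (ℕ → ℝ) × (ℕ → ℝ) => S.piecewise p.1 p.2 := by
  refine measurable_pi_lambda _ fun k => ?_
  by_cases hk : k ∈ S
  · simp only [Set.piecewise_eq_of_mem _ _ _ hk]; fun_prop
  · simp only [Set.piecewise_eq_of_notMem _ _ _ hk]; fun_prop

/-- Resampling the coordinates in `S` preserves the measure on the cube. -/
lemma measurePreserving_piecewise (S : Set ℕ) [∀ k, Decidable (k ∈ S)] :
    MeasurePreserving (fun p : (ℕ → ℝ) × (ℕ → ℝ) => S.piecewise p.1 p.2)
      (cubeMeasure.prod cubeMeasure) cubeMeasure := by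
  refine ⟨measurable_piecewise_prod S, ?_⟩
  refine Measure.eq_infinitePi _ fun s t ht => ?_
  rw [Measure.map_apply (measurable_piecewise_prod S)
    (MeasurableSet.pi s.countable_toSet fun k _ => ht k)]
  -- The preimage of a box is a product of two boxes: the first point is constrained on `S`, the
  -- second off `S`.
  have e : (fun p : (ℕ → ℝ) × (ℕ → ℝ) => S.piecewise p.1 p.2) ⁻¹' Set.pi s t =
      (Set.pi ↑(s.filter (· ∈ S)) t) ×ˢ (Set.pi ↑(s.filter (· ∉ S)) t) := by
    ext p
    simp only [Set.mem_preimage, Set.mem_pi, Set.mem_prod, Finset.mem_coe, Finset.mem_filter]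
    refine ⟨fun h => ⟨fun k hk => ?_, fun k hk => ?_⟩, fun h k hk => ?_⟩
    · simpa [hk.2] using h k hk.1
    · simpa [hk.2] using h k hk.1
    · by_cases hS : k ∈ S
      · simpa [hS] using h.1 k ⟨hk, hS⟩
      · simpa [hS] using h.2 k ⟨hk, hS⟩
  rw [e, Measure.prod_prod, cubeMeasure, Measure.infinitePi_pi _ fun k _ => ht k,
    Measure.infinitePi_pi _ fun k _ => ht k, Finset.prod_filter_mul_prod_filter_not]

/-! ### Mixed derivatives of finite sums of tensor products -/

/-- Differentiability is needed only at the coordinates `x k`, `k ∈ l`. Moving along direction `k ∉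
l` does not touch the coordinates in `l`, so the inner derivative has its product form on the whole
line and can be differentiated again. This makes the formula usable at almost every point. -/
lemma foldr_partialDeriv_sum_prod {ι : Type*} [Fintype ι] (b : ι → ℝ) (w : ι → ℕ → ℝ → ℝ)
    (s : Finset ℕ) (l : List ℕ) (hl : l.Nodup) (hs : ∀ k ∈ l, k ∈ s) (x : ℕ → ℝ)
    (hx : ∀ k ∈ l, ∀ i, DifferentiableAt ℝ (w i k) (x k)) :
    l.foldr partialDeriv (fun x => ∑ i, b i * ∏ k ∈ s, w i k (x k)) x =
      ∑ i, b i * ∏ k ∈ s, (if k ∈ l then deriv (w i k) else w i k) (x k) := by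
  induction l generalizing x with
  | nil => simp
  | cons k l ih =>
    rw [List.nodup_cons] at hl
    have hk : k ∈ s := hs k (by simp)
    have key : ∀ t, l.foldr partialDeriv (fun x => ∑ i, b i * ∏ k ∈ s, w i k (x k))
        (Function.update x k t) = ∑ i, b i * (w i k t * ∏ j ∈ s.erase k,
          (if j ∈ l then deriv (w i j) else w i j) (x j)) := by
      intro t
      rw [ih hl.2 (fun j hj => hs j (by simp [hj]))]
      · refine Finset.sum_congr rfl fun i _ => ?_
        rw [← Finset.mul_prod_erase s _ hk]
        congr 2
        · simp [hl.1]
        · refine Finset.prod_congr rfl fun j hj => ?_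
          rw [Function.update_of_ne (Finset.ne_of_mem_erase hj)]
      · intro j hj i
        have hjk : j ≠ k := fun h => hl.1 (h ▸ hj)
        rw [Function.update_of_ne hjk]
        exact hx j (by simp [hj]) i
    rw [List.foldr_cons, partialDeriv]
    simp_rw [key]
    rw [deriv_fun_sum fun i _ =>
      ((hx k (by simp) i).mul_const _).const_mul _]
    refine Finset.sum_congr rfl fun i _ => ?_
    rw [deriv_const_mul_field, deriv_mul_const_field, ← Finset.mul_prod_erase s _ hk]
    congr 2
    · simp
    · refine Finset.prod_congr rfl fun j hj => ?_
      simp [Finset.ne_of_mem_erase hj]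

/-- A scalar multiple of a tensor product of functions in `H¹`, the variables of which form a set
in the support of `γ`. Factors for the other variables are `1`. -/
structure ElementaryTensor (γ : Finset ℕ → ℝ) where
  coeff : ℝ
  supp : Finset ℕ
  factor : ℕ → ℝ → ℝ
  supp_pos : 0 < γ supp
  memH1 : ∀ k, MemH1 (factor k)
  factor_eq_one : ∀ k ∉ supp, factor k = fun _ => 1

variable {γ : Finset ℕ → ℝ} {ι κ : Type} [Fintype ι] [Fintype κ]

/-- The function given by a finite family of elementary tensors. -/
def tensorSum (T : ι → ElementaryTensor γ) : (ℕ → ℝ) → ℝ :=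
  fun x => ∑ i, (T i).coeff * ∏ k ∈ (T i).supp, (T i).factor k (x k)

/-- The negative of an elementary tensor. -/
def ElementaryTensor.neg (T : ElementaryTensor γ) : ElementaryTensor γ :=
  { T with coeff := -T.coeff }

lemma exists_tensorSum_of_mem {f : (ℕ → ℝ) → ℝ} (hf : f ∈ tensorSpan γ) :
    ∃ (n : ℕ) (T : Fin n → ElementaryTensor γ), f = tensorSum T := by
  classical
  obtain ⟨n, c, g, rfl⟩ := Submodule.mem_span_set'.1 hf
  choose ω u hω hu hg using fun i => (g i).2
  refine ⟨n, fun i => ⟨c i, ω i, fun k => if k ∈ ω i then u i k else fun _ => 1, hω i, ?_, ?_⟩, ?_⟩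
  · intro k
    by_cases hk : k ∈ ω i
    · simpa [hk] using hu i k hk
    · simpa [hk] using memH1_const 1
  · intro k hk
    simp [hk]
  · ext x
    simp only [tensorSum, Finset.sum_apply, Pi.smul_apply, smul_eq_mul, hg]
    refine Finset.sum_congr rfl fun i _ => ?_
    congr 1
    refine Finset.prod_congr rfl fun k hk => ?_
    simp [hk]

/-- The mixed derivative of the `η`-term of the decomposition of `tensorSum T` which is built from
the functional `φ`. -/
def tensorDeriv (φ : (ℝ → ℝ) → ℝ) (T : ι → ElementaryTensor γ) (η : Finset ℕ) : (ℕ → ℝ) → ℝ :=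
  fun x => ∑ i, (T i).coeff * ((∏ k ∈ (T i).supp \ η, φ ((T i).factor k)) *
    ∏ k ∈ η, -deriv ((T i).factor k) (x k))

/-- Differences are again families of elementary tensors, so bounds for one family apply directly to
the differences in the Cauchy condition. -/
lemma tensorSum_sub (T : ι → ElementaryTensor γ) (U : κ → ElementaryTensor γ) :
    tensorSum (Sum.elim T fun i => (U i).neg) = tensorSum T - tensorSum U := by
  ext x
  simp [tensorSum, ElementaryTensor.neg, sub_eq_add_neg]

lemma tensorDeriv_sub (φ : (ℝ → ℝ) → ℝ) (T : ι → ElementaryTensor γ)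
    (U : κ → ElementaryTensor γ) :
    tensorDeriv φ (Sum.elim T fun i => (U i).neg) = tensorDeriv φ T - tensorDeriv φ U := by
  ext η x
  simp [tensorDeriv, ElementaryTensor.neg, sub_eq_add_neg]

lemma measurable_tensorDeriv (φ : (ℝ → ℝ) → ℝ) (T : ι → ElementaryTensor γ) (η : Finset ℕ) :
    Measurable (tensorDeriv φ T η) := by
  unfold tensorDeriv
  have : ∀ i k, Measurable (deriv ((T i).factor k)) := fun i k => measurable_deriv _
  fun_prop

lemma memLp_tensorDeriv (φ : (ℝ → ℝ) → ℝ) (T : ι → ElementaryTensor γ) (η : Finset ℕ) :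
    MemLp (tensorDeriv φ T η) 2 cubeMeasure := by
  unfold tensorDeriv
  refine memLp_finsetSum _ fun i _ => ((MemLp.const_mul ?_ _).const_mul _)
  exact memLp_prod_cubeMeasure (g := fun k t => -deriv ((T i).factor k) t)
    (fun k => (measurable_deriv _).neg) fun k _ => ((T i).memH1 k).2.neg

/-- Terms for sets which are not contained in the support of some tensor vanish. -/
lemma tensorDeriv_eq_zero (φ : (ℝ → ℝ) → ℝ) (T : ι → ElementaryTensor γ) {η : Finset ℕ}
    (h : ∀ i, ¬ η ⊆ (T i).supp) : tensorDeriv φ T η = 0 := by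
  ext x
  refine Finset.sum_eq_zero fun i _ => ?_
  obtain ⟨k, hk, hk'⟩ := Finset.not_subset.1 (h i)
  rw [Finset.prod_eq_zero hk (by simp [(T i).factor_eq_one k hk']), mul_zero, mul_zero]

/-- `B S` applies the functional `φ` to the variables with index in `S`. -/
structure IsProjectionFamily (φ : (ℝ → ℝ) → ℝ)
    (B : Set ℕ → ((ℕ → ℝ) → ℝ) → (ℕ → ℝ) → ℝ) : Prop where
  map_one : φ (fun _ => 1) = 1
  apply_sum_prod : ∀ (ι : Type) [Fintype ι] (S : Set ℕ) [DecidablePred (· ∈ S)] (c : ι → ℝ)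
    (ω : ι → Finset ℕ) (v : ι → ℕ → ℝ → ℝ), (∀ i k, Integrable (v i k) intervalMeasure) →
    B S (fun x => ∑ i, c i * ∏ k ∈ ω i, v i k (x k)) =
      fun x => ∑ i, c i * ∏ k ∈ ω i, (if k ∈ S then fun _ => φ (v i k) else v i k) (x k)

lemma isProjectionFamily_integrateOut :
    IsProjectionFamily (fun u => ∫ t, u t ∂intervalMeasure) integrateOut where
  map_one := by simp
  apply_sum_prod ι _ S _ c ω v hv := by
    classical
    ext x
    have hg : ∀ i k, Integrable (if k ∈ S then v i k else fun _ => v i k (x k))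
        intervalMeasure := by
      intro i k
      split_ifs
      · exact hv i k
      · exact integrable_const _
    have e : integrateOut S (fun x => ∑ i, c i * ∏ k ∈ ω i, v i k (x k)) x = ∫ t, ∑ i, c i *
        ∏ k ∈ ω i, (if k ∈ S then v i k else fun _ => v i k (x k)) (t k) ∂cubeMeasure := by
      rw [integrateOut]
      congr 1 with t
      refine Finset.sum_congr rfl fun i _ => ?_
      congr 1
      refine Finset.prod_congr rfl fun k _ => ?_
      by_cases hk : k ∈ S <;> simp [hk]
    rw [e, integral_finsetSum _ fun i _ =>
      (integrable_prod_cubeMeasure fun k _ => hg i k).const_mul _]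
    refine Finset.sum_congr rfl fun i _ => ?_
    rw [integral_const_mul, integral_prod_cubeMeasure fun k _ => hg i k]
    congr 1
    refine Finset.prod_congr rfl fun k _ => ?_
    by_cases hk : k ∈ S <;> simp [hk]

lemma isProjectionFamily_anchorAt (a : ℝ) :
    IsProjectionFamily (fun u => u a) (anchorAt a) where
  map_one := rfl
  apply_sum_prod ι _ S _ c ω v _ := by
    ext x
    simp only [anchorAt]
    refine Finset.sum_congr rfl fun i _ => ?_
    congr 1
    refine Finset.prod_congr rfl fun k _ => ?_
    by_cases hk : k ∈ S <;> simp [hk]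

/-- The `ω`-term of the decomposition built from the projections `B`. -/
def decompositionTerm (B : Set ℕ → ((ℕ → ℝ) → ℝ) → (ℕ → ℝ) → ℝ) (ω : Finset ℕ)
    (f : (ℕ → ℝ) → ℝ) : (ℕ → ℝ) → ℝ :=
  fun x => ∑ η ∈ ω.powerset, (-1 : ℝ) ^ (ω.card - η.card) *
    B (η : Set ℕ) (B ((ω : Set ℕ)ᶜ) f) x

/-- The alternating sum over subsets of `η` is the expansion of `∏ (φ u_k - u_k)`. This fixes the
sign: each later derivative is `-u_k'`. -/
lemma decompositionTerm_tensorSum {φ : (ℝ → ℝ) → ℝ}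
    {B : Set ℕ → ((ℕ → ℝ) → ℝ) → (ℕ → ℝ) → ℝ} (hB : IsProjectionFamily φ B)
    (T : ι → ElementaryTensor γ) (η : Finset ℕ) :
    decompositionTerm B η (tensorSum T) = fun x => ∑ i, ((T i).coeff *
      ∏ k ∈ (T i).supp \ η, φ ((T i).factor k)) *
      ∏ k ∈ η, (φ ((T i).factor k) - (T i).factor k (x k)) := by
  classical
  ext x
  have key : ∀ (s : Finset ℕ), s ⊆ η → B (s : Set ℕ) (B ((η : Set ℕ)ᶜ) (tensorSum T)) x =
      ∑ i, ((T i).coeff * ∏ k ∈ (T i).supp \ η, φ ((T i).factor k)) *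
        ((∏ k ∈ s, φ ((T i).factor k)) * ∏ k ∈ η \ s, (T i).factor k (x k)) := by
    intro s hs
    unfold tensorSum
    rw [hB.apply_sum_prod _ _ _ _ _ fun i k => ((T i).memH1 k).integrable,
      hB.apply_sum_prod _ _ _ _ (fun i k => if k ∈ ((η : Set ℕ)ᶜ) then
        fun _ => φ ((T i).factor k) else (T i).factor k) fun i k => ?_]
    · refine Finset.sum_congr rfl fun i _ => ?_
      have e1 : (∏ k ∈ s, φ ((T i).factor k)) * ∏ k ∈ η \ s, (T i).factor k (x k) =
          ∏ k ∈ η, (if k ∈ s then φ ((T i).factor k) else (T i).factor k (x k)) := by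
        rw [Finset.prod_ite, Finset.filter_mem_eq_inter, Finset.inter_eq_right.2 hs,
          Finset.filter_notMem_eq_sdiff]
      -- Factors outside the support are `1` and `φ 1 = 1`, so they contribute nothing.
      have e2 : ∏ k ∈ η, (if k ∈ s then φ ((T i).factor k) else (T i).factor k (x k)) =
          ∏ k ∈ (T i).supp ∩ η,
            (if k ∈ s then φ ((T i).factor k) else (T i).factor k (x k)) := by
        symm
        refine Finset.prod_subset Finset.inter_subset_right fun k hk hk' => ?_
        have hk'' : k ∉ (T i).supp := fun h => hk' (Finset.mem_inter.2 ⟨h, hk⟩)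
        simp [(T i).factor_eq_one k hk'', hB.map_one]
      rw [e1, e2, mul_assoc, ← Finset.prod_inter_mul_prod_sdiff (T i).supp η, mul_comm (∏ k ∈ (T i).supp ∩ η, _)]
      congr 2
      · refine Finset.prod_congr rfl fun k hk => ?_
        have h := (Finset.mem_sdiff.1 hk).2
        have h' : k ∉ s := fun h' => h (hs h')
        simp [h, h']
      · refine Finset.prod_congr rfl fun k hk => ?_
        have h := (Finset.mem_inter.1 hk).2
        by_cases h' : k ∈ s <;> simp [h, h']
    · split_ifs
      · exact integrable_const _
      · exact ((T i).memH1 k).integrable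
  rw [decompositionTerm, Finset.sum_congr rfl fun s hs => by
    rw [key s (Finset.mem_powerset.1 hs), Finset.mul_sum], Finset.sum_comm]
  refine Finset.sum_congr rfl fun i _ => ?_
  simp_rw [sub_eq_add_neg, Finset.prod_add, Finset.mul_sum]
  refine Finset.sum_congr rfl fun s hs => ?_
  rw [Finset.prod_neg, Finset.card_sdiff_of_subset (Finset.mem_powerset.1 hs)]
  ring

/-- Absolutely continuous factors are differentiable almost everywhere. With finitely many tensors
and countably many coordinates, almost every point of the cube is good for all of them at once. -/
lemma mixedDeriv_decompositionTerm {φ : (ℝ → ℝ) → ℝ}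
    {B : Set ℕ → ((ℕ → ℝ) → ℝ) → (ℕ → ℝ) → ℝ} (hB : IsProjectionFamily φ B)
    (T : ι → ElementaryTensor γ) (η : Finset ℕ) :
    mixedDeriv η (decompositionTerm B η (tensorSum T)) =ᵐ[cubeMeasure] tensorDeriv φ T η := by
  have hd : ∀ᵐ x ∂cubeMeasure, ∀ k i, DifferentiableAt ℝ ((T i).factor k) (x k) := by
    rw [ae_all_iff]
    intro k
    rw [ae_all_iff]
    intro i
    exact (measurePreserving_eval_cubeMeasure k).quasiMeasurePreserving.ae
      ((T i).memH1 k).ae_differentiableAt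
  filter_upwards [hd] with x hx
  rw [mixedDeriv, decompositionTerm_tensorSum hB, foldr_partialDeriv_sum_prod _
    (fun i k t => φ ((T i).factor k) - (T i).factor k t) _ _ (Finset.sort_nodup _ _)
    (by simp) _ fun k _ i => (hx k i).const_sub _, tensorDeriv]
  refine Finset.sum_congr rfl fun i _ => ?_
  rw [mul_assoc]
  congr 2
  refine Finset.prod_congr rfl fun k hk => ?_
  simp [hk]

/-! ### Averages over some of the variables -/

open Classical in
/-- Integrate the variables with index in `s` against the product kernel `∏ k ∈ s, K (t k)`. -/
def kernelAverage (K : ℝ → ℝ) (s : Finset ℕ) (g : (ℕ → ℝ) → ℝ) : (ℕ → ℝ) → ℝ :=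
  fun x => ∫ t, (∏ k ∈ s, K (t k)) * g ((s : Set ℕ).piecewise t x) ∂cubeMeasure

lemma stronglyMeasurable_kernelAverage {K : ℝ → ℝ} (hK : Measurable K) (s : Finset ℕ)
    {g : (ℕ → ℝ) → ℝ} (hg : Measurable g) : StronglyMeasurable (kernelAverage K s g) := by
  classical
  have h : Measurable fun p : (ℕ → ℝ) × (ℕ → ℝ) =>
      (∏ k ∈ s, K (p.1 k)) * g ((s : Set ℕ).piecewise p.1 p.2) := by
    refine Measurable.mul (by fun_prop) (hg.comp ?_)
    exact measurable_piecewise_prod (s : Set ℕ)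
  convert! h.stronglyMeasurable.integral_prod_left' (μ := cubeMeasure)

lemma lintegral_prod_kernel_sq {K : ℝ → ℝ} {q : ℝ} (hL : MemLp K 2 intervalMeasure)
    (hq : ∫ t, K t ^ 2 ∂intervalMeasure = q) (s : Finset ℕ) :
    ∫⁻ t, ‖∏ k ∈ s, K (t k)‖ₑ ^ 2 ∂cubeMeasure = ENNReal.ofReal (q ^ s.card) := by
  have hi : ∀ k ∈ s, Integrable ((fun (_ : ℕ) t => K t ^ 2) k) intervalMeasure :=
    fun k _ => hL.integrable_sq
  have h := integral_prod_cubeMeasure hi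
  have h' := integrable_prod_cubeMeasure hi
  simp only [hq, Finset.prod_const] at h
  rw [← h, ofReal_integral_eq_lintegral_ofReal h'
    (ae_of_all _ fun t => Finset.prod_nonneg fun k _ => sq_nonneg _)]
  refine lintegral_congr fun t => ?_
  rw [← enorm_pow, Finset.prod_pow, Real.enorm_of_nonneg (sq_nonneg _)]

lemma eLpNorm_two_sq {X : Type*} [MeasurableSpace X] (μ : Measure X) (f : X → ℝ) :
    eLpNorm f 2 μ ^ 2 = ∫⁻ x, ‖f x‖ₑ ^ 2 ∂μ := by
  have := eLpNorm_nnreal_pow_eq_lintegral (f := f) (μ := μ) (p := 2) two_ne_zero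
  simpa using this

lemma lintegral_mul_sq_le {X : Type*} [MeasurableSpace X] (μ : Measure X) {f g : X → ℝ≥0∞}
    (hf : AEMeasurable f μ) (hg : AEMeasurable g μ) :
    (∫⁻ x, f x * g x ∂μ) ^ 2 ≤ (∫⁻ x, f x ^ 2 ∂μ) * ∫⁻ x, g x ^ 2 ∂μ := by
  have h := ENNReal.lintegral_mul_le_Lp_mul_Lq μ Real.HolderConjugate.two_two hf hg
  simp only [Pi.mul_apply, ENNReal.rpow_two] at h
  calc _ ≤ _ := pow_le_pow_left₀ zero_le h 2
    _ = _ := by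
      rw [mul_pow, ← ENNReal.rpow_two, ← ENNReal.rpow_two, ← ENNReal.rpow_mul,
        ← ENNReal.rpow_mul]
      norm_num

/-- Cauchy–Schwarz in the resampled variables for fixed `x` splits off `∫ ∏ K² = q^|s|`. Integrating
over `x` restores the norm of `g`, because resampling preserves the measure. -/
lemma eLpNorm_kernelAverage_le {K : ℝ → ℝ} {q : ℝ} (hK : Measurable K)
    (hL : MemLp K 2 intervalMeasure)
    (hq : ∫ t, K t ^ 2 ∂intervalMeasure = q) (s : Finset ℕ)
    {g : (ℕ → ℝ) → ℝ} (hg : Measurable g) :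
    eLpNorm (kernelAverage K s g) 2 cubeMeasure ^ 2
      ≤ ENNReal.ofReal (q ^ s.card) * eLpNorm g 2 cubeMeasure ^ 2 := by
  classical
  have hp := measurePreserving_piecewise (s : Set ℕ)
  have hm := measurable_piecewise_prod (s : Set ℕ)
  have e : ∫⁻ x, ‖g x‖ₑ ^ 2 ∂cubeMeasure =
      ∫⁻ x, ∫⁻ t, ‖g ((s : Set ℕ).piecewise t x)‖ₑ ^ 2 ∂cubeMeasure ∂cubeMeasure := by
    rw [← hp.lintegral_comp (by fun_prop), lintegral_prod_symm' _ (by fun_prop)]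
  rw [eLpNorm_two_sq, eLpNorm_two_sq, e, ← lintegral_const_mul _
    (Measurable.lintegral_prod_left' (f := fun p => ‖g ((s : Set ℕ).piecewise p.1 p.2)‖ₑ ^ 2)
      (by fun_prop))]
  refine lintegral_mono fun x => ?_
  rw [← lintegral_prod_kernel_sq hL hq]
  have hm' := hm.comp (measurable_id.prodMk (measurable_const (a := x)))
  refine le_trans ?_ (lintegral_mul_sq_le _ (Measurable.aemeasurable (by fun_prop))
    (Measurable.aemeasurable ?_))
  · refine pow_le_pow_left₀ zero_le ?_ 2
    refine (enorm_integral_le_lintegral_enorm _).trans ?_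
    simp_rw [enorm_mul]
    exact le_rfl
  · exact (hg.comp hm').enorm

/-- The functional `ψ` differs from `φ` by integration of `-u'` against the kernel `K`. -/
structure IsKernelPair (q : ℝ) (K : ℝ → ℝ) (φ ψ : (ℝ → ℝ) → ℝ) : Prop where
  measurable : Measurable K
  memLp : MemLp K 2 intervalMeasure
  integral_sq : ∫ t, K t ^ 2 ∂intervalMeasure = q
  left_one : φ (fun _ => 1) = 1
  right_one : ψ (fun _ => 1) = 1
  right_eq : ∀ u, MemH1 u → ψ u = (∫ t, K t * -deriv u t ∂intervalMeasure) + φ u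

/-- Exchanging the two functionals only flips the sign of the kernel, so both directions of the
comparison have the same `q`. -/
lemma isKernelPair_mean_anchor {a : ℝ} (ha : a ∈ Set.Icc (0 : ℝ) 1) :
    IsKernelPair (anchorConst a) (fun t => -anchorKernel a t)
      (fun u => ∫ t, u t ∂intervalMeasure) (fun u => u a) where
  measurable := (measurable_anchorKernel a).neg
  memLp := (memLp_anchorKernel ha).neg
  integral_sq := by simpa using integral_anchorKernel_sq ha
  left_one := by simp
  right_one := rfl
  right_eq u hu := by simp [hu.integral_anchorKernel_mul_deriv ha]

lemma isKernelPair_anchor_mean {a : ℝ} (ha : a ∈ Set.Icc (0 : ℝ) 1) :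
    IsKernelPair (anchorConst a) (anchorKernel a)
      (fun u => u a) (fun u => ∫ t, u t ∂intervalMeasure) where
  measurable := measurable_anchorKernel a
  memLp := memLp_anchorKernel ha
  integral_sq := integral_anchorKernel_sq ha
  left_one := rfl
  right_one := by simp
  right_eq u hu := by simp [integral_neg, hu.integral_anchorKernel_mul_deriv ha]

lemma kernelAverage_tensorDeriv {q : ℝ} {K : ℝ → ℝ} {φ ψ : (ℝ → ℝ) → ℝ}
    (hK : IsKernelPair q K φ ψ) (T : ι → ElementaryTensor γ) {ω s : Finset ℕ}
    (hs : Disjoint ω s) (x : ℕ → ℝ) :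
    kernelAverage K s (tensorDeriv φ T (ω ∪ s)) x = ∑ i, (T i).coeff *
      ((∏ k ∈ (T i).supp \ (ω ∪ s), φ ((T i).factor k)) *
        ((∏ k ∈ ω, -deriv ((T i).factor k) (x k)) *
          ∏ k ∈ s, ∫ t, K t * -deriv ((T i).factor k) t ∂intervalMeasure)) := by
  classical
  have hi : ∀ i, ∀ k ∈ s, Integrable ((fun k t => K t * -deriv ((T i).factor k) t) k)
      intervalMeasure := fun i k _ => hK.memLp.integrable_mul ((T i).memH1 k).2.neg
  have e : kernelAverage K s (tensorDeriv φ T (ω ∪ s)) x = ∫ t, ∑ i, ((T i).coeff *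
      (∏ k ∈ (T i).supp \ (ω ∪ s), φ ((T i).factor k)) *
        (∏ k ∈ ω, -deriv ((T i).factor k) (x k))) *
          ∏ k ∈ s, (K (t k) * -deriv ((T i).factor k) (t k)) ∂cubeMeasure := by
    rw [kernelAverage]
    congr 1 with t
    rw [tensorDeriv, Finset.mul_sum]
    refine Finset.sum_congr rfl fun i _ => ?_
    have e1 : ∏ k ∈ ω, -deriv ((T i).factor k) ((s : Set ℕ).piecewise t x k) =
        ∏ k ∈ ω, -deriv ((T i).factor k) (x k) := by
      refine Finset.prod_congr rfl fun k hk => ?_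
      rw [Set.piecewise_eq_of_notMem _ _ _ (by simpa using Finset.disjoint_left.1 hs hk)]
    have e2 : ∏ k ∈ s, -deriv ((T i).factor k) ((s : Set ℕ).piecewise t x k) =
        ∏ k ∈ s, -deriv ((T i).factor k) (t k) := by
      refine Finset.prod_congr rfl fun k hk => ?_
      rw [Set.piecewise_eq_of_mem _ _ _ (by simpa using hk)]
    rw [Finset.prod_union hs, Finset.prod_mul_distrib, ← e2, ← e1]
    ring_nf
  rw [e, integral_finsetSum _ fun i _ => (integrable_prod_cubeMeasure (hi i)).const_mul _]
  refine Finset.sum_congr rfl fun i _ => ?_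
  rw [integral_const_mul, integral_prod_cubeMeasure (hi i)]
  ring

/-- This puts tensors with different supports over one common index set `Ω`. -/
lemma prod_sdiff_supp {φ : (ℝ → ℝ) → ℝ} (h1 : φ (fun _ => 1) = 1) (T : ElementaryTensor γ)
    {Ω : Finset ℕ} (hΩ : T.supp ⊆ Ω) (s : Finset ℕ) :
    ∏ k ∈ Ω \ s, φ (T.factor k) = ∏ k ∈ T.supp \ s, φ (T.factor k) := by
  symm
  refine Finset.prod_subset (Finset.sdiff_subset_sdiff hΩ le_rfl) fun k hk hk' => ?_
  rw [T.factor_eq_one k fun h => hk' (Finset.mem_sdiff.2 ⟨h, (Finset.mem_sdiff.1 hk).2⟩), h1]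

/-- Outside `ω`, each factor `ψ u_k` is `∫ K (-u_k') + φ u_k`. In the expanded product, `s` collects
the variables where the integral is chosen, and the corresponding summand is the average of the
derivative for `ω ∪ s`. -/
lemma tensorDeriv_eq_sum_kernelAverage {q : ℝ} {K : ℝ → ℝ} {φ ψ : (ℝ → ℝ) → ℝ}
    (hK : IsKernelPair q K φ ψ) (T : ι → ElementaryTensor γ) {Ω : Finset ℕ}
    (hΩ : ∀ i, (T i).supp ⊆ Ω) (ω : Finset ℕ) :
    tensorDeriv ψ T ω =
      ∑ s ∈ (Ω \ ω).powerset, kernelAverage K s (tensorDeriv φ T (ω ∪ s)) := by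
  ext x
  rw [Finset.sum_apply, Finset.sum_congr rfl fun s hs => kernelAverage_tensorDeriv hK T
    (Finset.disjoint_sdiff.mono_right (Finset.mem_powerset.1 hs)) x, Finset.sum_comm, tensorDeriv]
  refine Finset.sum_congr rfl fun i _ => ?_
  rw [← Finset.mul_sum, ← prod_sdiff_supp hK.right_one _ (hΩ i)]
  congr 1
  rw [Finset.prod_congr rfl fun k _ => hK.right_eq _ ((T i).memH1 k), Finset.prod_add,
    Finset.sum_mul]
  refine Finset.sum_congr rfl fun s _ => ?_
  rw [← prod_sdiff_supp hK.left_one _ (hΩ i), sdiff_sdiff]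
  simp only [Finset.sup_eq_union]
  ring

lemma eLpNorm_tensorDeriv_le {q : ℝ} (hq : 0 ≤ q) {K : ℝ → ℝ} {φ ψ : (ℝ → ℝ) → ℝ}
    (hK : IsKernelPair q K φ ψ) (T : ι → ElementaryTensor γ) {Ω : Finset ℕ}
    (hΩ : ∀ i, (T i).supp ⊆ Ω) (ω : Finset ℕ) :
    (eLpNorm (tensorDeriv ψ T ω) 2 cubeMeasure).toReal ≤
      ∑ s ∈ (Ω \ ω).powerset, √(q ^ s.card) *
        (eLpNorm (tensorDeriv φ T (ω ∪ s)) 2 cubeMeasure).toReal := by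
  have hfin : ∀ s, eLpNorm (tensorDeriv φ T (ω ∪ s)) 2 cubeMeasure ≠ ⊤ :=
    fun s => (memLp_tensorDeriv φ T _).2.ne
  have h1 : ∀ s, eLpNorm (kernelAverage K s (tensorDeriv φ T (ω ∪ s))) 2 cubeMeasure ≤
      ENNReal.ofReal (√(q ^ s.card) *
        (eLpNorm (tensorDeriv φ T (ω ∪ s)) 2 cubeMeasure).toReal) := by
    intro s
    have h := eLpNorm_kernelAverage_le hK.measurable hK.memLp hK.integral_sq s
      (measurable_tensorDeriv φ T (ω ∪ s))
    rw [← (ENNReal.pow_right_strictMono two_ne_zero).le_iff_le]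
    refine h.trans (le_of_eq ?_)
    rw [ENNReal.ofReal_mul (Real.sqrt_nonneg _), ENNReal.ofReal_toReal (hfin s), mul_pow,
      ← ENNReal.ofReal_pow (Real.sqrt_nonneg _), Real.sq_sqrt (pow_nonneg hq _)]
  refine ENNReal.toReal_le_of_le_ofReal
    (Finset.sum_nonneg fun s _ => mul_nonneg (Real.sqrt_nonneg _) ENNReal.toReal_nonneg) ?_
  rw [tensorDeriv_eq_sum_kernelAverage hK T hΩ ω, ENNReal.ofReal_sum_of_nonneg
    fun s _ => mul_nonneg (Real.sqrt_nonneg _) ENNReal.toReal_nonneg]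
  refine (eLpNorm_sum_le (fun s _ => (stronglyMeasurable_kernelAverage hK.measurable s
    (measurable_tensorDeriv φ T _)).aestronglyMeasurable) one_le_two).trans ?_
  exact Finset.sum_le_sum fun s _ => h1 s

/-! ### The norm inequality on the span of the tensor products -/

/-- Cauchy–Schwarz after splitting each summand as `√(q^|s| α) * (y / √α)`, with `α` and `y` taken
at `ω ∪ s`. The sum of the `q^|s| α` is controlled by the upper condition divided by `q^|ω|`. -/
lemma sum_sq_le_of_le_sum {a : ℝ} {α : Finset ℕ → ℝ} (hα : ∀ ω, 0 < γ ω → 0 < α ω)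
    {C' : ℝ} (hupper : UpperSumCondition a γ α C') {Ω ω : Finset ℕ} (hω : 0 < γ ω) (hωΩ : ω ⊆ Ω)
    {x y : Finset ℕ → ℝ} (hx : 0 ≤ x ω) (hy : ∀ η, ¬ 0 < γ η → y η = 0)
    (hxy : x ω ≤ ∑ s ∈ (Ω \ ω).powerset, √(anchorConst a ^ s.card) * y (ω ∪ s)) :
    x ω ^ 2 ≤ C' * α ω * ∑ η ∈ Ω.powerset with 0 < γ η ∧ ω ⊆ η, y η ^ 2 / α η := by
  set q := anchorConst a with hq
  have hq0 : 0 < q := anchorConst_pos a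
  have hαω := hα ω hω
  set P := (Ω \ ω).powerset.filter fun s => 0 < γ (ω ∪ s) with hP
  have hdisj : ∀ s ∈ P, Disjoint ω s := fun s hs =>
    Finset.disjoint_sdiff.mono_right (Finset.mem_powerset.1 (Finset.mem_filter.1 hs).1)
  have hinj : Set.InjOn (fun s => ω ∪ s) (P : Set (Finset ℕ)) := by
    intro s hs t ht hst
    rw [← Finset.union_sdiff_cancel_left (hdisj s hs),
      ← Finset.union_sdiff_cancel_left (hdisj t ht), show ω ∪ s = ω ∪ t from hst]
  have hmem : ∀ η ∈ P.image (ω ∪ ·), η ⊆ Ω ∧ 0 < γ η ∧ ω ⊆ η := by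
    intro η hη
    obtain ⟨s, hs, rfl⟩ := Finset.mem_image.1 hη
    have hs' := Finset.mem_filter.1 hs
    exact ⟨Finset.union_subset hωΩ
      ((Finset.mem_powerset.1 hs'.1).trans Finset.sdiff_subset), hs'.2, Finset.subset_union_left⟩
  have h1 : x ω ≤ ∑ s ∈ P, √(q ^ s.card) * y (ω ∪ s) := by
    refine hxy.trans (le_of_eq (Finset.sum_filter_of_ne fun s _ hs => ?_).symm)
    by_contra h
    exact hs (by rw [hy _ h, mul_zero])
  have h2 : (∑ s ∈ P, √(q ^ s.card) * y (ω ∪ s)) ^ 2 ≤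
      (∑ s ∈ P, q ^ s.card * α (ω ∪ s)) * ∑ s ∈ P, y (ω ∪ s) ^ 2 / α (ω ∪ s) := by
    refine Finset.sum_sq_le_sum_mul_sum_of_sq_le_mul _ (fun s hs => ?_) (fun s hs => ?_)
      fun s hs => ?_
    all_goals have hpos := hα _ (Finset.mem_filter.1 hs).2
    · positivity
    · positivity
    · rw [mul_pow, Real.sq_sqrt (by positivity)]
      field_simp
      exact le_rfl
  have h3 : ∑ s ∈ P, y (ω ∪ s) ^ 2 / α (ω ∪ s) ≤
      ∑ η ∈ Ω.powerset with 0 < γ η ∧ ω ⊆ η, y η ^ 2 / α η := by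
    rw [← Finset.sum_image (f := fun η => y η ^ 2 / α η) hinj]
    refine Finset.sum_le_sum_of_subset_of_nonneg (fun η hη => ?_) fun η hη _ => ?_
    · simpa using hmem η hη
    · have := hα η (Finset.mem_filter.1 hη).2.1
      positivity
  have h4 : ∑ s ∈ P, q ^ s.card * α (ω ∪ s) ≤ C' * α ω := by
    obtain ⟨hsum, hle⟩ := hupper ω hω
    -- The sets `ω ∪ s` form a finite part of the convergent series over supersets of `ω`.
    have h5 : ∑ η ∈ P.image (ω ∪ ·), q ^ η.card * α η ≤ C' * (q ^ ω.card * α ω) := by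
      rw [← Finset.sum_subtype_of_mem (p := fun η => 0 < γ η ∧ ω ⊆ η) _
        fun η hη => (hmem η hη).2]
      refine (hsum.sum_le_tsum _ fun η _ => ?_).trans hle
      have := hα η.1 η.2.1
      positivity
    rw [Finset.sum_image hinj, Finset.sum_congr rfl fun s hs => by
      rw [Finset.card_union_of_disjoint (hdisj s hs), pow_add, mul_assoc],
      ← Finset.mul_sum] at h5
    have : 0 < q ^ ω.card := by positivity
    refine le_of_mul_le_mul_left (h5.trans (le_of_eq ?_)) this
    ring
  have h6 : 0 ≤ ∑ s ∈ P, y (ω ∪ s) ^ 2 / α (ω ∪ s) := Finset.sum_nonneg fun s hs => by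
    have := hα _ (Finset.mem_filter.1 hs).2
    positivity
  have h7 : 0 ≤ ∑ s ∈ P, q ^ s.card * α (ω ∪ s) := Finset.sum_nonneg fun s hs => by
    have := hα _ (Finset.mem_filter.1 hs).2
    positivity
  calc x ω ^ 2 ≤ _ := pow_le_pow_left₀ hx h1 2
    _ ≤ _ := h2
    _ ≤ _ := mul_le_mul h4 h3 h6 (h7.trans h4)

/-- After the weighted Cauchy–Schwarz bound, the sum runs over pairs `ω₀ ⊆ ω ⊆ η`. Summing over `ω`
first uses the lower condition. The constraint `ω₀ ⊆ ω` carries over to `η`, which is why sums over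
supersets can be compared. -/
lemma sum_inv_mul_sq_le {a : ℝ} {α : Finset ℕ → ℝ} (hα : ∀ ω, 0 < γ ω → 0 < α ω)
    {C' C'' : ℝ} (hC' : 0 < C') (hupper : UpperSumCondition a γ α C')
    (hlower : LowerSumCondition γ α C'') {Ω : Finset ℕ}
    {x y : Finset ℕ → ℝ} (hx : ∀ ω, 0 ≤ x ω) (hy : ∀ η, ¬ 0 < γ η → y η = 0)
    (hxy : ∀ ω, ω ⊆ Ω → x ω ≤ ∑ s ∈ (Ω \ ω).powerset, √(anchorConst a ^ s.card) * y (ω ∪ s))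
    (ω₀ : Finset ℕ) :
    ∑ ω ∈ Ω.powerset with 0 < γ ω ∧ ω₀ ⊆ ω, (γ ω)⁻¹ * x ω ^ 2 ≤
      C' * C'' * ∑ ω ∈ Ω.powerset with 0 < γ ω ∧ ω₀ ⊆ ω, (γ ω)⁻¹ * y ω ^ 2 := by
  calc ∑ ω ∈ Ω.powerset with 0 < γ ω ∧ ω₀ ⊆ ω, (γ ω)⁻¹ * x ω ^ 2
      ≤ ∑ ω ∈ Ω.powerset with 0 < γ ω ∧ ω₀ ⊆ ω,
        ∑ η ∈ Ω.powerset with 0 < γ η ∧ ω ⊆ η, (C' * (y η ^ 2 / α η)) * (α ω / γ ω) := by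
        refine Finset.sum_le_sum fun ω hω => ?_
        obtain ⟨hωΩ, hγω, -⟩ := by simpa using hω
        refine (mul_le_mul_of_nonneg_left (sum_sq_le_of_le_sum hα hupper hγω hωΩ (hx ω) hy
          (hxy ω hωΩ)) (inv_nonneg.2 hγω.le)).trans (le_of_eq ?_)
        rw [Finset.mul_sum, Finset.mul_sum]
        refine Finset.sum_congr rfl fun η _ => ?_
        ring
    _ = ∑ η ∈ Ω.powerset with 0 < γ η ∧ ω₀ ⊆ η,
        ∑ ω ∈ η.powerset with 0 < γ ω ∧ ω₀ ⊆ ω, (C' * (y η ^ 2 / α η)) * (α ω / γ ω) := by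
        refine Finset.sum_comm' fun ω η => ?_
        simp only [Finset.mem_filter, Finset.mem_powerset]
        exact ⟨fun h => ⟨⟨h.2.2.2, h.1.2.1, h.1.2.2⟩, h.2.1, h.2.2.1, h.1.2.2.trans h.2.2.2⟩,
          fun h => ⟨⟨h.1.1.trans h.2.1, h.1.2⟩, h.2.1, h.2.2.1, h.1.1⟩⟩
    _ ≤ ∑ η ∈ Ω.powerset with 0 < γ η ∧ ω₀ ⊆ η, C' * C'' * ((γ η)⁻¹ * y η ^ 2) := by
        refine Finset.sum_le_sum fun η hη => ?_
        obtain ⟨-, hγη, -⟩ := by simpa using hη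
        have hαη := hα η hγη
        rw [← Finset.mul_sum]
        have h : ∑ ω ∈ η.powerset with 0 < γ ω ∧ ω₀ ⊆ ω, α ω / γ ω ≤ C'' * (α η / γ η) := by
          refine le_trans ?_ (hlower η hγη)
          refine le_trans (Finset.sum_le_sum_of_subset_of_nonneg (t := η.powerset.filter
            fun ω => 0 < γ ω) ?_ ?_) (le_of_eq ?_)
          · exact Finset.monotone_filter_right _ fun ω _ h => h.1
          · intro ω hω _
            have := (Finset.mem_filter.1 hω).2
            exact (div_pos (hα ω this) this).le
          · congr!
        refine (mul_le_mul_of_nonneg_left h (by positivity)).trans (le_of_eq ?_)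
        field_simp
    _ = _ := by rw [Finset.mul_sum]

lemma weightedSum_congr {g h : Finset ℕ → (ℕ → ℝ) → ℝ}
    (hgh : ∀ ω, g ω =ᵐ[cubeMeasure] h ω) (ω₀ : Finset ℕ) :
    weightedSum γ g ω₀ = weightedSum γ h ω₀ := by
  unfold weightedSum
  simp_rw [fun ω => eLpNorm_congr_ae (p := 2) (hgh ω)]

lemma weightedSum_eq_sum {g : Finset ℕ → (ℕ → ℝ) → ℝ} {Ω : Finset ℕ}
    (hg : ∀ ω, MemLp (g ω) 2 cubeMeasure) (h0 : ∀ ω, ¬ ω ⊆ Ω → g ω = 0) (ω₀ : Finset ℕ) :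
    weightedSum γ g ω₀ = ENNReal.ofReal (∑ ω ∈ Ω.powerset with 0 < γ ω ∧ ω₀ ⊆ ω,
      (γ ω)⁻¹ * (eLpNorm (g ω) 2 cubeMeasure).toReal ^ 2) := by
  have hval : ∀ ω, ENNReal.ofReal (γ ω)⁻¹ * eLpNorm (g ω) 2 cubeMeasure ^ 2 =
      ENNReal.ofReal ((γ ω)⁻¹ * (eLpNorm (g ω) 2 cubeMeasure).toReal ^ 2) := by
    intro ω
    rw [ENNReal.ofReal_mul' (sq_nonneg _), ENNReal.ofReal_pow ENNReal.toReal_nonneg,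
      ENNReal.ofReal_toReal (hg ω).2.ne]
  rw [weightedSum, ENNReal.ofReal_sum_of_nonneg]
  · simp_rw [← hval]
    rw [Finset.sum_filter]
    have := tsum_subtype {ω : Finset ℕ | 0 < γ ω ∧ ω₀ ⊆ ω}
      fun ω => ENNReal.ofReal (γ ω)⁻¹ * eLpNorm (g ω) 2 cubeMeasure ^ 2
    refine this.trans ?_
    rw [tsum_eq_sum (s := Ω.powerset)]
    · refine Finset.sum_congr rfl fun ω _ => ?_
      simp [Set.indicator_apply]
    · intro ω hω
      rw [Finset.mem_powerset] at hω
      simp [h0 ω hω]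
  · intro ω hω
    have := (Finset.mem_filter.1 hω).2.1
    positivity

lemma exists_supp_subset (T : ι → ElementaryTensor γ) : ∃ Ω : Finset ℕ, ∀ i, (T i).supp ⊆ Ω :=
  ⟨Finset.univ.biUnion fun i => (T i).supp, fun i =>
    Finset.subset_biUnion_of_mem (fun i => (T i).supp) (Finset.mem_univ i)⟩

lemma weightedSum_tensorDeriv_eq {φ : (ℝ → ℝ) → ℝ}
    (T : ι → ElementaryTensor γ) {Ω : Finset ℕ} (hΩ : ∀ i, (T i).supp ⊆ Ω) (ω₀ : Finset ℕ) :
    weightedSum γ (tensorDeriv φ T) ω₀ = ENNReal.ofReal (∑ ω ∈ Ω.powerset with 0 < γ ω ∧ ω₀ ⊆ ω,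
      (γ ω)⁻¹ * (eLpNorm (tensorDeriv φ T ω) 2 cubeMeasure).toReal ^ 2) :=
  weightedSum_eq_sum (memLp_tensorDeriv φ T)
    (fun _ hω => tensorDeriv_eq_zero φ T fun i hi => hω (hi.trans (hΩ i))) ω₀

lemma weightedSum_tensorDeriv_lt_top (φ : (ℝ → ℝ) → ℝ)
    (T : ι → ElementaryTensor γ) (ω₀ : Finset ℕ) : weightedSum γ (tensorDeriv φ T) ω₀ < ⊤ := by
  obtain ⟨Ω, hΩ⟩ := exists_supp_subset T
  rw [weightedSum_tensorDeriv_eq T hΩ]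
  exact ENNReal.ofReal_lt_top

lemma weightedSum_tensorDeriv_le {a : ℝ} (hγ : IsWeight γ) {α : Finset ℕ → ℝ}
    (hα : ∀ ω, 0 < γ ω → 0 < α ω) {C' C'' : ℝ} (hC' : 0 < C') (hC'' : 0 < C'')
    (hupper : UpperSumCondition a γ α C') (hlower : LowerSumCondition γ α C'')
    {K : ℝ → ℝ} {φ ψ : (ℝ → ℝ) → ℝ} (hK : IsKernelPair (anchorConst a) K φ ψ)
    (T : ι → ElementaryTensor γ) (ω₀ : Finset ℕ) :
    weightedSum γ (tensorDeriv ψ T) ω₀ ≤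
      ENNReal.ofReal (C' * C'') * weightedSum γ (tensorDeriv φ T) ω₀ := by
  obtain ⟨Ω, hΩ⟩ := exists_supp_subset T
  rw [weightedSum_tensorDeriv_eq T hΩ, weightedSum_tensorDeriv_eq T hΩ,
    ← ENNReal.ofReal_mul (by positivity)]
  refine ENNReal.ofReal_le_ofReal (sum_inv_mul_sq_le hα hC' hupper hlower
    (fun _ => ENNReal.toReal_nonneg) (fun η hη => ?_)
    (fun ω _ => eLpNorm_tensorDeriv_le (anchorConst_pos a).le hK T hΩ ω) ω₀)
  -- If `η` lay inside the support of some tensor, its weight would be positive, since the support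
  -- of `γ` is closed under subsets.
  rw [tensorDeriv_eq_zero φ T fun i hi =>
    hη (hγ.monotone_support _ _ hi (T i).supp_pos)]
  simp

/-! ### Completeness -/

/-- The measure on pairs of a finite set and a point of the cube for which `weightedSum γ g ω₀` is
the square of an `L₂` norm. -/
def termMeasure (γ : Finset ℕ → ℝ) (ω₀ : Finset ℕ) : Measure (Σ _ : Finset ℕ, ℕ → ℝ) :=
  Measure.sum fun ω : {ω : Finset ℕ // 0 < γ ω ∧ ω₀ ⊆ ω} =>
    ENNReal.ofReal (γ ω.1)⁻¹ • cubeMeasure.map fun x => ⟨ω.1, x⟩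

/-- A family of functions on the cube as one function. -/
def joinTerms (g : Finset ℕ → (ℕ → ℝ) → ℝ) : (Σ _ : Finset ℕ, ℕ → ℝ) → ℝ :=
  fun p => g p.1 p.2

lemma measurable_sigmaMk (ω : Finset ℕ) :
    Measurable fun x : ℕ → ℝ => (⟨ω, x⟩ : Σ _ : Finset ℕ, ℕ → ℝ) :=
  measurable_iff_le_map.2 (iInf_le _ ω)

lemma measurable_joinTerms {g : Finset ℕ → (ℕ → ℝ) → ℝ} (hg : ∀ ω, Measurable (g ω)) :
    Measurable (joinTerms g) := by
  intro s hs
  rw [Sigma.instMeasurableSpace, MeasurableSpace.measurableSet_iInf]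
  exact fun ω => hg ω hs

lemma eLpNorm_joinTerms_sq {g : Finset ℕ → (ℕ → ℝ) → ℝ} (hg : ∀ ω, Measurable (g ω))
    (ω₀ : Finset ℕ) :
    eLpNorm (joinTerms g) 2 (termMeasure γ ω₀) ^ 2 = weightedSum γ g ω₀ := by
  rw [eLpNorm_two_sq, termMeasure, lintegral_sum_measure, weightedSum]
  refine tsum_congr fun ω => ?_
  rw [lintegral_smul_measure, lintegral_map ((measurable_joinTerms hg).enorm.pow_const 2)
    (measurable_sigmaMk _), eLpNorm_two_sq, smul_eq_mul]
  rfl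

lemma termMeasure_le (γ : Finset ℕ → ℝ) (ω₀ : Finset ℕ) :
    termMeasure γ ω₀ ≤ termMeasure γ ∅ := by
  refine Measure.le_iff.2 fun s hs => ?_
  rw [termMeasure, termMeasure, Measure.sum_apply _ hs, Measure.sum_apply _ hs]
  exact ENNReal.tsum_comp_le_tsum_of_injective
    (f := fun ω : {ω : Finset ℕ // 0 < γ ω ∧ ω₀ ⊆ ω} =>
      (⟨ω.1, ω.2.1, Finset.empty_subset _⟩ : {ω : Finset ℕ // 0 < γ ω ∧ ∅ ⊆ ω}))
    (fun ω η h => Subtype.ext (congrArg (fun ξ => ξ.1) h))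
    fun ω => (ENNReal.ofReal (γ ω.1)⁻¹ • cubeMeasure.map fun x => ⟨ω.1, x⟩) s

lemma tendsto_zero_of_sq_tendsto_zero {β : Type*} {l : Filter β} {u : β → ℝ≥0∞}
    (h : Tendsto (fun i => u i ^ 2) l (𝓝 0)) : Tendsto u l (𝓝 0) := by
  have := (ENNReal.continuous_rpow_const (y := 1 / 2)).tendsto 0 |>.comp h
  simp only [Function.comp_def, ← ENNReal.rpow_two, ← ENNReal.rpow_mul] at this
  simpa using this

lemma tendsto_eLpNorm_of_sub {X : Type*} [MeasurableSpace X] {μ : Measure X} {u : ℕ → X → ℝ}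
    {v : X → ℝ} (hu : ∀ n, AEStronglyMeasurable (u n) μ) (hv : AEStronglyMeasurable v μ)
    (h : Tendsto (fun n => eLpNorm (u n - v) 2 μ) atTop (𝓝 0)) :
    Tendsto (fun n => eLpNorm (u n) 2 μ) atTop (𝓝 (eLpNorm v 2 μ)) := by
  have lo : Tendsto (fun n => eLpNorm v 2 μ - eLpNorm (u n - v) 2 μ) atTop
      (𝓝 (eLpNorm v 2 μ)) := by
    simpa using ENNReal.Tendsto.sub tendsto_const_nhds h (Or.inr ENNReal.zero_ne_top)
  have hi : Tendsto (fun n => eLpNorm v 2 μ + eLpNorm (u n - v) 2 μ) atTop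
      (𝓝 (eLpNorm v 2 μ)) := by
    simpa using tendsto_const_nhds.add h
  refine tendsto_of_tendsto_of_tendsto_of_le_of_le lo hi (fun n => ?_) fun n => ?_
  · rw [tsub_le_iff_right]
    have := eLpNorm_sub_le (hu n) ((hu n).sub hv) one_le_two
    rwa [sub_sub_cancel] at this
  · have := eLpNorm_add_le hv ((hu n).sub hv) one_le_two
    rwa [add_sub_cancel] at this

/-- The limit is taken measurable everywhere, so that its slices over the individual sets `ω` are
measurable functions on the cube. -/
lemma exists_measurable_limit {X : Type*} [MeasurableSpace X] {μ : Measure X} {u : ℕ → X → ℝ}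
    (hu : ∀ n, MemLp (u n) 2 μ)
    (h : Tendsto (fun p : ℕ × ℕ => eLpNorm (u p.1 - u p.2) 2 μ) atTop (𝓝 0)) :
    ∃ v : X → ℝ, Measurable v ∧ MemLp v 2 μ ∧
      Tendsto (fun n => eLpNorm (u n - v) 2 μ) atTop (𝓝 0) := by
  have hc : CauchySeq fun n => (hu n).toLp (u n) := by
    refine EMetric.cauchySeq_iff.2 fun ε hε => ?_
    obtain ⟨⟨N, M⟩, hN⟩ := eventually_atTop.1 (h.eventually (gt_mem_nhds hε))
    refine ⟨max N M, fun m hm n hn => ?_⟩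
    rw [Lp.edist_toLp_toLp]
    exact hN (m, n) ⟨(le_max_left _ _).trans hm, (le_max_right _ _).trans hn⟩
  obtain ⟨v, hv⟩ := cauchySeq_tendsto_of_complete hc
  have hm := Lp.aestronglyMeasurable v
  refine ⟨hm.mk v, hm.stronglyMeasurable_mk.measurable, (Lp.memLp v).ae_eq hm.ae_eq_mk, ?_⟩
  have := (tendsto_iff_edist_tendsto_0.1 hv)
  refine this.congr fun n => ?_
  rw [Lp.edist_def]
  refine eLpNorm_congr_ae ?_
  filter_upwards [(hu n).coeFn_toLp, hm.ae_eq_mk] with x h1 h2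
  simp [h1, ← h2]

lemma term_le_weightedSum (g : Finset ℕ → (ℕ → ℝ) → ℝ) {ω : Finset ℕ} (hω : 0 < γ ω) :
    ENNReal.ofReal (γ ω)⁻¹ * eLpNorm (g ω) 2 cubeMeasure ^ 2 ≤ weightedSum γ g ∅ :=
  ENNReal.le_tsum (f := fun ω : {ω : Finset ℕ // 0 < γ ω ∧ ∅ ⊆ ω} =>
    ENNReal.ofReal (γ ω.1)⁻¹ * eLpNorm (g ω.1) 2 cubeMeasure ^ 2)
    ⟨ω, hω, Finset.empty_subset _⟩

lemma sq_eLpNorm_le_weightedSum (g : Finset ℕ → (ℕ → ℝ) → ℝ) {ω : Finset ℕ} (hω : 0 < γ ω) :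
    eLpNorm (g ω) 2 cubeMeasure ^ 2 ≤ ENNReal.ofReal (γ ω) * weightedSum γ g ∅ := by
  refine le_trans (le_of_eq ?_) (mul_le_mul_right (term_le_weightedSum g hω) _)
  rw [← mul_assoc, ← ENNReal.ofReal_mul hω.le, mul_inv_cancel₀ hω.ne', ENNReal.ofReal_one, one_mul]

/-- Families of mixed derivatives which form a Cauchy sequence converge. -/
lemma exists_limit_family {h : ℕ → Finset ℕ → (ℕ → ℝ) → ℝ} (hm : ∀ n ω, Measurable (h n ω))
    (hfin : ∀ n, weightedSum γ (h n) ∅ < ⊤)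
    (hc : Tendsto (fun p : ℕ × ℕ => weightedSum γ (h p.1 - h p.2) ∅) atTop (𝓝 0)) :
    ∃ g : Finset ℕ → (ℕ → ℝ) → ℝ,
      (∀ ω, 0 < γ ω → MemLp (g ω) 2 cubeMeasure ∧
        Tendsto (fun n => eLpNorm (h n ω - g ω) 2 cubeMeasure) atTop (𝓝 0)) ∧
      weightedSum γ g ∅ < ⊤ ∧
      ∀ ω₀, Tendsto (fun n => weightedSum γ (h n) ω₀) atTop (𝓝 (weightedSum γ g ω₀)) := by
  have hL : ∀ n, MemLp (joinTerms (h n)) 2 (termMeasure γ ∅) := by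
    intro n
    refine ⟨(measurable_joinTerms (hm n)).aestronglyMeasurable, ?_⟩
    have := hfin n
    rw [← eLpNorm_joinTerms_sq (hm n)] at this
    exact (ENNReal.pow_lt_top_iff.1 this).resolve_right two_ne_zero
  obtain ⟨v, hv, hvL, hlim⟩ := exists_measurable_limit hL (tendsto_zero_of_sq_tendsto_zero
    (hc.congr fun p => (eLpNorm_joinTerms_sq (fun ω => (hm p.1 ω).sub (hm p.2 ω)) ∅).symm))
  have hg : ∀ ω, Measurable fun x => v ⟨ω, x⟩ := fun ω => hv.comp (measurable_sigmaMk ω)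
  have hfin' : weightedSum γ (fun ω x => v ⟨ω, x⟩) ∅ < ⊤ := by
    rw [← eLpNorm_joinTerms_sq hg]
    exact ENNReal.pow_lt_top hvL.2
  have hsub : Tendsto (fun n => weightedSum γ (h n - fun ω x => v ⟨ω, x⟩) ∅) atTop (𝓝 0) := by
    have := (ENNReal.continuous_pow 2).tendsto 0 |>.comp hlim
    simp only [ne_eq, OfNat.ofNat_ne_zero, not_false_eq_true, zero_pow] at this
    exact this.congr fun n => eLpNorm_joinTerms_sq (fun ω => (hm n ω).sub (hg ω)) ∅
  refine ⟨fun ω x => v ⟨ω, x⟩, fun ω hω => ⟨⟨(hg ω).aestronglyMeasurable, ?_⟩, ?_⟩, hfin', ?_⟩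
  · have := (sq_eLpNorm_le_weightedSum (fun ω x => v ⟨ω, x⟩) hω).trans_lt
      (ENNReal.mul_lt_top ENNReal.ofReal_lt_top hfin')
    exact (ENNReal.pow_lt_top_iff.1 this).resolve_right two_ne_zero
  · refine tendsto_zero_of_sq_tendsto_zero ?_
    refine tendsto_of_tendsto_of_tendsto_of_le_of_le tendsto_const_nhds
      (h := fun n => ENNReal.ofReal (γ ω) * weightedSum γ (h n - fun ω x => v ⟨ω, x⟩) ∅)
      ?_ (fun n => zero_le) fun n =>
      sq_eLpNorm_le_weightedSum (h n - fun ω x => v ⟨ω, x⟩) hω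
    simpa using ENNReal.Tendsto.const_mul hsub (Or.inr ENNReal.ofReal_ne_top)
  · intro ω₀
    -- Restricting to supersets of `ω₀` only shrinks the measure, so convergence for `∅` gives
    -- convergence for every `ω₀`.
    have h1 : Tendsto (fun n => eLpNorm (joinTerms (h n) - v) 2 (termMeasure γ ω₀)) atTop
        (𝓝 0) :=
      tendsto_of_tendsto_of_tendsto_of_le_of_le tendsto_const_nhds hlim (fun n => zero_le)
        fun n => eLpNorm_mono_measure _ (termMeasure_le γ ω₀)
    have h2 := tendsto_eLpNorm_of_sub
      (fun n => (measurable_joinTerms (hm n)).aestronglyMeasurable) hv.aestronglyMeasurable h1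
    have h3 := ((ENNReal.continuous_pow 2).tendsto _).comp h2
    have e : eLpNorm v 2 (termMeasure γ ω₀) ^ 2 = weightedSum γ (fun ω x => v ⟨ω, x⟩) ω₀ :=
      eLpNorm_joinTerms_sq hg ω₀
    rw [e] at h3
    exact h3.congr fun n => eLpNorm_joinTerms_sq (hm n) ω₀

/-! ### Comparison of the sensitivity indices -/

lemma anovaDeriv_tensorSum (T : ι → ElementaryTensor γ) (ω : Finset ℕ) :
    anovaDeriv (tensorSum T) ω =ᵐ[cubeMeasure]
      tensorDeriv (fun u => ∫ t, u t ∂intervalMeasure) T ω :=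
  mixedDeriv_decompositionTerm isProjectionFamily_integrateOut T ω

lemma anchoredDeriv_tensorSum (a : ℝ) (T : ι → ElementaryTensor γ) (ω : Finset ℕ) :
    anchoredDeriv a (tensorSum T) ω =ᵐ[cubeMeasure] tensorDeriv (fun u => u a) T ω :=
  mixedDeriv_decompositionTerm (isProjectionFamily_anchorAt a) T ω

/-- The common denominator leaves the sum. If it vanishes, so does the numerator, and `0 / 0 = 0` in
`ℝ≥0∞` is the intended convention. -/
lemma totalIndex_eq (γ : Finset ℕ → ℝ) (g : Finset ℕ → (ℕ → ℝ) → ℝ) (ω₀ : Finset ℕ) :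
    totalIndex γ g ω₀ = (weightedSum γ g ω₀ / normSq γ g).toReal := by
  rw [totalIndex]
  simp only [sobolIndex, div_eq_mul_inv, ENNReal.tsum_mul_right]
  rfl

lemma weightedSum_le_normSq (γ : Finset ℕ → ℝ) (g : Finset ℕ → (ℕ → ℝ) → ℝ) (ω₀ : Finset ℕ) :
    weightedSum γ g ω₀ ≤ normSq γ g :=
  ENNReal.tsum_comp_le_tsum_of_injective
    (f := fun ω : {ω : Finset ℕ // 0 < γ ω ∧ ω₀ ⊆ ω} =>
      (⟨ω.1, ω.2.1, Finset.empty_subset _⟩ : {ω : Finset ℕ // 0 < γ ω ∧ ∅ ⊆ ω}))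
    (fun _ _ h => Subtype.ext (congrArg (fun ξ => ξ.1) h))
    fun ω => ENNReal.ofReal (γ ω.1)⁻¹ * eLpNorm (g ω.1) 2 cubeMeasure ^ 2

/-- Multiply `u ≤ C v` by `V ≤ C U`. The remaining inequality `U ≤ C V` makes the denominators
vanish together, and then both quotients are `0`. -/
lemma div_le_sq_mul_div {C u v U V : ℝ} (hu : 0 ≤ u) (hU : 0 ≤ U) (hV : 0 ≤ V)
    (huv : u ≤ C * v) (hVU : V ≤ C * U) (hUV : U ≤ C * V) : u / U ≤ C ^ 2 * (v / V) := by
  rcases hU.eq_or_lt with rfl | hU'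
  · have : V = 0 := le_antisymm (by simpa using hVU) hV
    simp [this]
  have hV' : 0 < V := hV.lt_of_ne fun h => by
    rw [← h, mul_zero] at hUV
    exact hU'.not_ge hUV
  rw [← mul_div_assoc, div_le_div_iff₀ hU' hV']
  nlinarith [mul_le_mul huv hVU hV (hu.trans huv)]

lemma totalIndex_nonneg (γ : Finset ℕ → ℝ) (g : Finset ℕ → (ℕ → ℝ) → ℝ) (ω₀ : Finset ℕ) :
    0 ≤ totalIndex γ g ω₀ := ENNReal.toReal_nonneg

/-- Comparable weighted sums give comparable total sensitivity indices. -/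
lemma totalIndex_le {C : ℝ} (hC : 0 ≤ C) {g h : Finset ℕ → (ℕ → ℝ) → ℝ}
    (hg : normSq γ g < ⊤) (hh : normSq γ h < ⊤)
    (hgh : ∀ ω₀, weightedSum γ g ω₀ ≤ ENNReal.ofReal C * weightedSum γ h ω₀)
    (hhg : ∀ ω₀, weightedSum γ h ω₀ ≤ ENNReal.ofReal C * weightedSum γ g ω₀) (ω₀ : Finset ℕ) :
    totalIndex γ g ω₀ ≤ C ^ 2 * totalIndex γ h ω₀ := by
  have toReal_le : ∀ {x y : ℝ≥0∞}, y < ⊤ → x ≤ ENNReal.ofReal C * y →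
      x.toReal ≤ C * y.toReal := by
    intro x y hy hxy
    refine (ENNReal.toReal_mono (ENNReal.mul_lt_top ENNReal.ofReal_lt_top hy).ne hxy).trans_eq ?_
    rw [ENNReal.toReal_mul, ENNReal.toReal_ofReal hC]
  rw [totalIndex_eq, totalIndex_eq, ENNReal.toReal_div, ENNReal.toReal_div]
  exact div_le_sq_mul_div ENNReal.toReal_nonneg ENNReal.toReal_nonneg ENNReal.toReal_nonneg
    (toReal_le ((weightedSum_le_normSq γ h ω₀).trans_lt hh) (hgh ω₀))
    (toReal_le hg (hhg ∅)) (toReal_le hh (hgh ∅))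

lemma totalIndex_comparable {C : ℝ} (hC : 0 < C) {g h : Finset ℕ → (ℕ → ℝ) → ℝ}
    (hg : normSq γ g < ⊤) (hh : normSq γ h < ⊤)
    (hgh : ∀ ω₀, weightedSum γ g ω₀ ≤ ENNReal.ofReal C * weightedSum γ h ω₀)
    (hhg : ∀ ω₀, weightedSum γ h ω₀ ≤ ENNReal.ofReal C * weightedSum γ g ω₀) (ω₀ : Finset ℕ) :
    (totalIndex γ g ω₀ = 0 ↔ totalIndex γ h ω₀ = 0) ∧
      (totalIndex γ h ω₀ ≠ 0 → (C ^ 2)⁻¹ ≤ totalIndex γ g ω₀ / totalIndex γ h ω₀ ∧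
        totalIndex γ g ω₀ / totalIndex γ h ω₀ ≤ C ^ 2) := by
  have h1 := totalIndex_le hC.le hg hh hgh hhg ω₀
  have h2 := totalIndex_le hC.le hh hg hhg hgh ω₀
  have hg0 := totalIndex_nonneg γ g ω₀
  have hh0 := totalIndex_nonneg γ h ω₀
  refine ⟨⟨fun h0 => ?_, fun h0 => ?_⟩, fun hne => ?_⟩
  · rw [h0, mul_zero] at h2
    exact le_antisymm h2 hh0
  · rw [h0, mul_zero] at h1
    exact le_antisymm h1 hg0
  · have hpos : 0 < totalIndex γ h ω₀ := hh0.lt_of_ne' hne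
    refine ⟨?_, by rwa [div_le_iff₀ hpos]⟩
    rwa [le_div_iff₀ hpos, inv_mul_le_iff₀ (by positivity)]

/-- The `L₂` limits of the mixed derivatives, for a decomposition `D` of the span which is given by
the functional `φ`, along a Cauchy sequence. -/
lemma exists_limit_family_of_tensorSum {φ : (ℝ → ℝ) → ℝ}
    {D : ((ℕ → ℝ) → ℝ) → Finset ℕ → (ℕ → ℝ) → ℝ} {F : ℕ → (ℕ → ℝ) → ℝ} {m : ℕ → ℕ}
    {T : ∀ n, Fin (m n) → ElementaryTensor γ}
    (hD : ∀ n ω, D (F n) ω =ᵐ[cubeMeasure] tensorDeriv φ (T n) ω)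
    (hc : Tendsto (fun p : ℕ × ℕ =>
      weightedSum γ (tensorDeriv φ (T p.1) - tensorDeriv φ (T p.2)) ∅) atTop (𝓝 0)) :
    ∃ g, IsLimitFamily γ D F g ∧ normSq γ g < ⊤ ∧
      ∀ ω₀, Tendsto (fun n => weightedSum γ (tensorDeriv φ (T n)) ω₀) atTop
        (𝓝 (weightedSum γ g ω₀)) := by
  obtain ⟨g, hg, hfin, hlim⟩ := exists_limit_family
    (fun n ω => measurable_tensorDeriv φ (T n) ω)
    (fun n => weightedSum_tensorDeriv_lt_top φ (T n) ∅) hc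
  refine ⟨g, fun ω hω => ⟨(hg ω hω).1, (hg ω hω).2.congr fun n => eLpNorm_congr_ae ?_⟩, hfin,
    hlim⟩
  exact ((hD n ω).sub (ae_eq_refl _)).symm

end WeightedSobol

end

theorem corollary2
    (a : ℝ) (ha : a ∈ Set.Icc (0 : ℝ) 1)
    (γ : Finset ℕ → ℝ) (hγ : WeightedSobol.IsWeight γ)
    (α : Finset ℕ → ℝ) (hα : ∀ ω, 0 < γ ω → 0 < α ω)
    (C' C'' : ℝ) (hC' : 0 < C') (hC'' : 0 < C'')
    (hupper : WeightedSobol.UpperSumCondition a γ α C')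
    (hlower : WeightedSobol.LowerSumCondition γ α C'')
    (F : ℕ → (ℕ → ℝ) → ℝ)
    (hF : WeightedSobol.RepresentsElement γ (WeightedSobol.anovaNormSq γ) F ∨
      WeightedSobol.RepresentsElement γ (WeightedSobol.anchoredNormSq a γ) F) :
    ∃ gA gan : Finset ℕ → (ℕ → ℝ) → ℝ,
      WeightedSobol.IsLimitFamily γ WeightedSobol.anovaDeriv F gA ∧
      WeightedSobol.IsLimitFamily γ (WeightedSobol.anchoredDeriv a) F gan ∧
      WeightedSobol.normSq γ gA < ⊤ ∧ WeightedSobol.normSq γ gan < ⊤ ∧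
      ∀ ω₀ : Finset ℕ, 0 < γ ω₀ →
        (WeightedSobol.totalIndex γ gA ω₀ = 0 ↔ WeightedSobol.totalIndex γ gan ω₀ = 0) ∧
        (WeightedSobol.totalIndex γ gan ω₀ ≠ 0 →
          ((C' * C'') ^ 2)⁻¹ ≤
              WeightedSobol.totalIndex γ gA ω₀ / WeightedSobol.totalIndex γ gan ω₀ ∧
            WeightedSobol.totalIndex γ gA ω₀ / WeightedSobol.totalIndex γ gan ω₀ ≤
              (C' * C'') ^ 2) := by
  have hmem : ∀ n, F n ∈ WeightedSobol.tensorSpan γ := hF.elim (fun h => h.1) fun h => h.1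
  choose m T hT using fun n => WeightedSobol.exists_tensorSum_of_mem (hmem n)
  have hsub : ∀ i j, F i - F j =
      WeightedSobol.tensorSum (Sum.elim (T i) fun l => (T j l).neg) := fun i j => by
    rw [WeightedSobol.tensorSum_sub, ← hT, ← hT]
  have hDA : ∀ n ω, WeightedSobol.anovaDeriv (F n) ω =ᵐ[WeightedSobol.cubeMeasure]
      WeightedSobol.tensorDeriv _ (T n) ω := fun n ω => by
    rw [hT n]
    exact WeightedSobol.anovaDeriv_tensorSum (T n) ω
  have hDan : ∀ n ω, WeightedSobol.anchoredDeriv a (F n) ω =ᵐ[WeightedSobol.cubeMeasure]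
      WeightedSobol.tensorDeriv _ (T n) ω := fun n ω => by
    rw [hT n]
    exact WeightedSobol.anchoredDeriv_tensorSum a (T n) ω
  have hNA : ∀ i j, WeightedSobol.anovaNormSq γ (F i - F j) = WeightedSobol.weightedSum γ
      (WeightedSobol.tensorDeriv _ (Sum.elim (T i) fun l => (T j l).neg)) ∅ := fun i j => by
    rw [hsub]
    exact WeightedSobol.weightedSum_congr (WeightedSobol.anovaDeriv_tensorSum _) ∅
  have hNan : ∀ i j, WeightedSobol.anchoredNormSq a γ (F i - F j) = WeightedSobol.weightedSum γ
      (WeightedSobol.tensorDeriv _ (Sum.elim (T i) fun l => (T j l).neg)) ∅ := fun i j => by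
    rw [hsub]
    exact WeightedSobol.weightedSum_congr (WeightedSobol.anchoredDeriv_tensorSum a _) ∅
  have hle := fun {ι : Type} [Fintype ι] (T : ι → WeightedSobol.ElementaryTensor γ) =>
    WeightedSobol.weightedSum_tensorDeriv_le hγ hα hC' hC'' hupper hlower
      (WeightedSobol.isKernelPair_anchor_mean ha) T
  have hge := fun {ι : Type} [Fintype ι] (T : ι → WeightedSobol.ElementaryTensor γ) =>
    WeightedSobol.weightedSum_tensorDeriv_le hγ hα hC' hC'' hupper hlower
      (WeightedSobol.isKernelPair_mean_anchor ha) T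
  have squeeze : ∀ {u v : ℕ × ℕ → ℝ≥0∞}, Tendsto u atTop (𝓝 0) →
      (∀ p, v p ≤ ENNReal.ofReal (C' * C'') * u p) → Tendsto v atTop (𝓝 0) := fun hu huv => by
    refine tendsto_of_tendsto_of_tendsto_of_le_of_le tendsto_const_nhds ?_ (fun _ => zero_le) huv
    simpa using ENNReal.Tendsto.const_mul hu (Or.inr ENNReal.ofReal_ne_top)
  -- By the two-sided inequality on differences, a sequence that is Cauchy in one norm is Cauchy in
  -- the other. Both completions are therefore handled together.
  have hcauchy : Tendsto (fun p : ℕ × ℕ => WeightedSobol.anovaNormSq γ (F p.1 - F p.2)) atTop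
        (𝓝 0) ∧
      Tendsto (fun p : ℕ × ℕ => WeightedSobol.anchoredNormSq a γ (F p.1 - F p.2)) atTop
        (𝓝 0) := by
    rcases hF with h | h
    · refine ⟨h.2, squeeze h.2 fun p => ?_⟩
      rw [hNA, hNan]
      exact hge _ ∅
    · refine ⟨squeeze h.2 fun p => ?_, h.2⟩
      rw [hNA, hNan]
      exact hle _ ∅
  simp only [hNA, hNan, WeightedSobol.tensorDeriv_sub] at hcauchy
  obtain ⟨gA, hA, hAfin, hAlim⟩ :=
    WeightedSobol.exists_limit_family_of_tensorSum hDA hcauchy.1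
  obtain ⟨gan, han, hanfin, hanlim⟩ :=
    WeightedSobol.exists_limit_family_of_tensorSum hDan hcauchy.2
  refine ⟨gA, gan, hA, han, hAfin, hanfin, fun ω₀ _ => ?_⟩
  refine WeightedSobol.totalIndex_comparable (mul_pos hC' hC'') hAfin hanfin (fun ω => ?_)
    (fun ω => ?_) ω₀
  -- The inequality on the span holds for each `n` and each index set, and both weighted sums
  -- converge.
  · exact le_of_tendsto_of_tendsto' (hAlim ω)
      (ENNReal.Tendsto.const_mul (hanlim ω) (Or.inr ENNReal.ofReal_ne_top)) fun n => hle (T n) ω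
  · exact le_of_tendsto_of_tendsto' (hanlim ω)
      (ENNReal.Tendsto.const_mul (hAlim ω) (Or.inr ENNReal.ofReal_ne_top)) fun n => hge (T n) ω
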